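/- Let $n\ge 1$ and $m\ge 1$ be integers with $m\mid n$, and let $G=\mathrm{SL}_n(\mathbb{C})/\mu_m$, where $\mu_m\subset \mathrm{SL}_n(\mathbb{C})$ is the group of scalar matrices $\zeta I$ with $\zeta^m=1$; regard $G$ as an algebraic group over $\mathbb{C}$ and let $ZG$ be its centre. Let $N_2(G)$ be the set of $G$-conjugacy classes (under simultaneous conjugation) of triples $(s,t,u)$ of pairwise commuting elements of $G$ such that $s,t$ are semisimple, $u$ is unipotent, and the simultaneous centralizer $G_{s,t,u}$ contains no nontrivial torus. For commuting $s,t\in G$ put $\gamma_{s,t}=\tilde s\,\tilde t\,\tilde s^{-1}\tilde t^{-1}\in\mu_m$, where $\tilde s,\tilde t\in \mathrm{SL}_n(\mathbb{C})$ are any lifts of $s,t$. For $\gamma\in\mu_m$ let $N_2(G;\gamma)\subset N_2(G)$ be the subset of classes of triples $(s,t,u)$ with $\gamma_{s,t}=\gamma$. The group $(ZG)^2$ acts on classes of triples by $(z_1,z_2)\cdot(s,t,u)=(z_1s,z_2t,u)$. Then for every $\gamma\in\mu_m$ the set $N_2(G;\gamma)$ is stable under this action and is a $(ZG)^2$-torsor,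 that is, it is nonempty and $(ZG)^2$ acts on it simply transitively. In particular $n_2(G;\gamma):=\#N_2(G;\gamma)=(n/m)^2$ for every $\gamma\in\mu_m$, and $n_2(G):=\#N_2(G)=n^2/m$. -/

import Mathlib

open scoped MatrixGroups

noncomputable section

/-! ### Affine algebraic groups over `ℂ`

An affine algebraic group is handled as a group `G` (of `ℂ`-points) with its algebra
`A` of regular functions, a subalgebra of the algebra of all functions `G → ℂ`. -/

namespace AlgGrp

variable {G : Type} [Group G]

/-- Right translation by `g` on functions: `(R_g f)(x) = f (x g)`. -/
def rightTranslation (g : G) : Module.End ℂ (G → ℂ) :=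
  LinearMap.funLeft ℂ ℂ (fun x : G => x * g)

/-- `g` is semisimple: the eigenvectors of right translation by `g` in the algebra `A` of regular
functions span `A`. -/
def IsSemisimpleElt (A : Subalgebra ℂ (G → ℂ)) (g : G) : Prop :=
  Subalgebra.toSubmodule A ≤
    ⨆ c : ℂ, Module.End.eigenspace (rightTranslation g) c ⊓ Subalgebra.toSubmodule A

/-- `g` is unipotent: `R_g - 1` is locally nilpotent on the algebra `A` of regular functions. -/
def IsUnipotentElt (A : Subalgebra ℂ (G → ℂ)) (g : G) : Prop :=
  ∀ f ∈ A, ∃ k : ℕ, ((rightTranslation g - 1) ^ k) f = 0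

/-- The regular functions on the standard torus `(ℂˣ)^r`: the Laurent polynomials, that is, the
span of the characters `x ↦ ∏ i, x i ^ a i` with `a ∈ ℤ^r`. -/
def laurentFunctions (r : ℕ) : Submodule ℂ ((Fin r → ℂˣ) → ℂ) :=
  Submodule.span ℂ (Set.range fun (a : Fin r → ℤ) (x : Fin r → ℂˣ) => ∏ i, (x i : ℂ) ^ a i)

/-- The subgroup `T` is a torus: it is the image of a homomorphism `φ : (ℂˣ)^r → G` that is a
closed immersion of varieties, that is, pulling back along `φ` maps the regular functions on `G`
into and onto those on `(ℂˣ)^r`. -/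
def IsTorus (A : Subalgebra ℂ (G → ℂ)) (T : Subgroup G) : Prop :=
  ∃ (r : ℕ) (φ : (Fin r → ℂˣ) →* G),
    (Subalgebra.toSubmodule A).map (LinearMap.funLeft ℂ ℂ φ) = laurentFunctions r ∧ φ.range = T

/-- The subgroup `H` contains a nontrivial torus. -/
def ContainsNontrivialTorus (A : Subalgebra ℂ (G → ℂ)) (H : Subgroup G) : Prop :=
  ∃ T : Subgroup G, IsTorus A T ∧ T ≠ ⊥ ∧ T ≤ H

variable (G) in
/-- Triples of elements of `G` up to simultaneous conjugation. -/
abbrev TripleClass : Type := MulAction.orbitRel.Quotient (ConjAct G) (G × G × G)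

/-- The class of the triple `(s, t, u)`. -/
def tripleClass (s t u : G) : TripleClass G := Quotient.mk _ (s, t, u)

/-- `(z₁, z₂) · [(s, t, u)] = [(z₁ s, z₂ t, u)]` for `z₁, z₂` in the centre of `G`. -/
instance instCenterAction :
    MulAction (Subgroup.center G × Subgroup.center G) (TripleClass G) where
  smul z := Quotient.map' (fun x => ((z.1 : G) * x.1, (z.2 : G) * x.2.1, x.2.2)) (by
    rintro x y ⟨g, rfl⟩
    refine ⟨g, ?_⟩
    have h1 := Subgroup.mem_center_iff.1 z.1.2
    have h2 := Subgroup.mem_center_iff.1 z.2.2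
    simp only [Prod.smul_def, ConjAct.smul_def, Prod.mk.injEq,
      and_true]
    constructor
    · rw [← mul_assoc, h1, mul_assoc, mul_assoc, mul_assoc]
    · rw [← mul_assoc, h2, mul_assoc, mul_assoc, mul_assoc])
  one_smul c := by
    induction c using Quotient.inductionOn'
    change Quotient.mk'' _ = _
    simp
  mul_smul z w c := by
    induction c using Quotient.inductionOn'
    change Quotient.mk'' _ = Quotient.mk'' _
    simp [mul_assoc]

/-- `(s, t, u)` is a commuting triple with `s, t` semisimple and `u` unipotent whose simultaneous
centralizer contains no nontrivial torus. -/
structure IsN2Triple (A : Subalgebra ℂ (G → ℂ)) (s t u : G) : Prop where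
  comm_st : Commute s t
  comm_su : Commute s u
  comm_tu : Commute t u
  semisimple_s : IsSemisimpleElt A s
  semisimple_t : IsSemisimpleElt A t
  unipotent_u : IsUnipotentElt A u
  no_torus : ¬ ContainsNontrivialTorus A (Subgroup.centralizer {s, t, u})

/-- The set `N₂(G)` of conjugacy classes of triples as in `IsN2Triple`. -/
def N2 (A : Subalgebra ℂ (G → ℂ)) : Set (TripleClass G) :=
  {c | ∃ s t u : G, IsN2Triple A s t u ∧ c = tripleClass s t u}

/-- The subset `S` of the `Z`-set `X` is stable under `Z` and is a `Z`-torsor: it is nonempty and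
`Z` acts on it simply transitively. -/
def IsTorsorOn (Z : Type) [Group Z] {X : Type} [MulAction Z X] (S : Set X) : Prop :=
  S.Nonempty ∧ (∀ z : Z, ∀ x ∈ S, z • x ∈ S) ∧ ∀ x ∈ S, ∀ y ∈ S, ∃! z : Z, z • x = y

end AlgGrp

/-! ### The group `SL_n / μ_m` -/

namespace SLMod

/-- The group `μ_m` of scalar matrices `ζ • 1` in `SL_n(ℂ)` with `ζ ^ m = 1`. -/
def mu (n m : ℕ) : Subgroup SL(n, ℂ) where
  carrier := {g | ∃ ζ : ℂ, ζ ^ m = 1 ∧ (g : Matrix (Fin n) (Fin n) ℂ) = Matrix.scalar (Fin n) ζ}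
  one_mem' := ⟨1, by simp⟩
  mul_mem' := by
    rintro a b ⟨ζ, h1, h2⟩ ⟨ξ, h3, h4⟩
    exact ⟨ζ * ξ, by rw [mul_pow, h1, h3, one_mul], by
      rw [Matrix.SpecialLinearGroup.coe_mul, h2, h4, map_mul]⟩
  inv_mem' := by
    rintro a ⟨ζ, h1, h2⟩
    refine ⟨ζ⁻¹, by rw [inv_pow, h1, inv_one], ?_⟩
    rcases Nat.eq_zero_or_pos n with rfl | hn
    · exact Subsingleton.elim _ _
    have h0 : ζ ≠ 0 := by
      rintro rfl
      have hd := a.2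
      have : Nonempty (Fin n) := ⟨⟨0, hn⟩⟩
      rw [h2, map_zero, Matrix.det_zero] at hd
      exact zero_ne_one hd
    have h5 : (a : Matrix (Fin n) (Fin n) ℂ) * (a⁻¹ : SL(n, ℂ)) = 1 := by
      rw [← Matrix.SpecialLinearGroup.coe_mul, mul_inv_cancel, Matrix.SpecialLinearGroup.coe_one]
    rw [h2] at h5
    calc ((a⁻¹ : SL(n, ℂ)) : Matrix (Fin n) (Fin n) ℂ)
        = (Matrix.scalar (Fin n) ζ⁻¹ * Matrix.scalar (Fin n) ζ) * (a⁻¹ : SL(n, ℂ)) := by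
          rw [← map_mul, inv_mul_cancel₀ h0, map_one, one_mul]
      _ = Matrix.scalar (Fin n) ζ⁻¹ := by rw [mul_assoc, h5, mul_one]

theorem mu_comm {n m : ℕ} {a : SL(n, ℂ)} (ha : a ∈ mu n m) (g : SL(n, ℂ)) : a * g = g * a := by
  obtain ⟨ζ, -, h⟩ := ha
  apply Subtype.ext
  rw [Matrix.SpecialLinearGroup.coe_mul, Matrix.SpecialLinearGroup.coe_mul, h]
  exact Matrix.scalar_commute ζ (fun r' => Commute.all ζ r') _

instance mu_normal (n m : ℕ) : (mu n m).Normal where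
  conj_mem a ha g := by rwa [← mu_comm ha g, mul_inv_cancel_right]

/-- The group `SL_n(ℂ) / μ_m` (it is used for `m ∣ n`). -/
abbrev Grp (n m : ℕ) : Type := SL(n, ℂ) ⧸ mu n m

/-- The algebra of regular functions on `SL_n / μ_m`: the functions whose pullback to `SL_n` is
polynomial in the matrix entries. -/
def regularFunctions (n m : ℕ) : Subalgebra ℂ (Grp n m → ℂ) where
  carrier := {f | ∃ p : MvPolynomial (Fin n × Fin n) ℂ, ∀ g : SL(n, ℂ),
    f (QuotientGroup.mk g) = MvPolynomial.eval (fun ij => g ij.1 ij.2) p}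
  mul_mem' := by
    rintro f f' ⟨p, hp⟩ ⟨q, hq⟩
    exact ⟨p * q, fun g => by rw [Pi.mul_apply, hp, hq, map_mul]⟩
  add_mem' := by
    rintro f f' ⟨p, hp⟩ ⟨q, hq⟩
    exact ⟨p + q, fun g => by rw [Pi.add_apply, hp, hq, map_add]⟩
  algebraMap_mem' c := ⟨MvPolynomial.C c, fun g => by simp⟩

/-- The element `γ_{s,t} = [s̃, t̃]` of `SL_n(ℂ)`, where `s̃, t̃` are lifts of `s, t` to the simply
connected cover `SL_n(ℂ)` of `SL_n(ℂ) / μ_m`. It lies in `μ_m` if `s` and `t` commute. -/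
def liftCommutator {n m : ℕ} (s t : Grp n m) : SL(n, ℂ) :=
  Quotient.liftOn₂' s t (fun x y => x * y * x⁻¹ * y⁻¹) (by
    intro a b a' b' ha hb
    rw [QuotientGroup.leftRel_apply] at ha hb
    obtain ⟨x, hx, rfl⟩ : ∃ x ∈ mu n m, a' = a * x := ⟨a⁻¹ * a', ha, by simp⟩
    obtain ⟨y, hy, rfl⟩ : ∃ y ∈ mu n m, b' = b * y := ⟨b⁻¹ * b', hb, by simp⟩
    have h1 : a * x * (b * y) * (a * x)⁻¹ = a * (b * y) * a⁻¹ := by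
      rw [mul_assoc a x, mu_comm hx (b * y)]; group
    have h2 : a * (b * y) * a⁻¹ = a * b * a⁻¹ * y := by
      rw [mul_assoc (a * b) a⁻¹ y, ← mu_comm hy a⁻¹]; group
    rw [h1, h2]; group)

/-- The set `N₂(G)` for `G = SL_n / μ_m`. -/
def N2 (n m : ℕ) : Set (AlgGrp.TripleClass (Grp n m)) := AlgGrp.N2 (regularFunctions n m)

/-- The set `N₂(G; γ)` for `G = SL_n / μ_m`: the classes of the triples with `γ_{s,t} = γ`. -/
def N2At (n m : ℕ) (γ : SL(n, ℂ)) : Set (AlgGrp.TripleClass (Grp n m)) :=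
  {c | ∃ s t u : Grp n m, AlgGrp.IsN2Triple (regularFunctions n m) s t u ∧
    liftCommutator s t = γ ∧ c = AlgGrp.tripleClass s t u}

end SLMod

end

/-! Lift `s, t` to `S, T` in `SL_n`, so that `S T = ζ T S` with `ζ ∈ μ_m` of order `d ∣ m`. A
unipotent `u` has a lift `U` with `N = U - 1` nilpotent, and a trace argument shows that `U`
commutes with `S` and `T` exactly.

If `ℂ^n` split as a sum of two nonzero `(S, T, N)`-stable subspaces, the determinant-one block
scalars would give a nontrivial torus in the centralizer (`containsNontrivialTorus_of_isCompl`). So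
`ℂ^n` is indecomposable. Since `S ^ d` and `T ^ d` are semisimple and commute with `S, T, N`, they
are scalars. Indecomposability then yields a basis `T ^ i N ^ j v` with `i < d`, `j < k`, `d k = n`
(`exists_isModel_of_isIndecomposable`). Such a model is determined up to conjugacy by `ζ`, `d`, `k`,
the eigenvalue `α` of `S` at `v`, and the scalar `b = T ^ d`.

Transitivity: scaling `S` and `T` moves `(α, b)` to any other pair of nonzero values, and
determinant one forces the scaling factors into `μ_n`, whose image in `G` is the centre. Freeness:
if `z s` is conjugate to `s`, comparing `d`-th powers of lifts shows that `z` comes from `μ_m`,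
because `d ∣ m`. Nonemptiness: the clock, shift and Jordan matrices form a model, and a model has no
torus in its centralizer, since an element commuting with it and of finite order modulo scalars is a
scalar (`IsModel.eq_smul_one`). The counts follow from `|ZG| = n / m` and `|μ_m| = m`. -/

noncomputable section

/-! ### Models: uniqueness, rescaling and commutant. -/

namespace CommutingPair

open Module

variable {V V' : Type*} [AddCommGroup V] [Module ℂ V] [AddCommGroup V'] [Module ℂ V']

/-- `S` and `T` commute up to the scalar `ζ`, and `V` has a basis `T ^ i (N ^ j v)` for `i < d` and
`j < k`, where `v` is an eigenvector of `S`, `T ^ d` is a scalar and `N ^ k v = 0`. -/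
structure IsModel (S T N : End ℂ V) (ζ α b : ℂ) (d k : ℕ) : Prop where
  comm_st : S * T = ζ • (T * S)
  comm_sn : Commute S N
  comm_tn : Commute T N
  pow_t : T ^ d = b • (1 : End ℂ V)
  exists_basis : ∃ v : V, S v = α • v ∧ (N ^ k) v = 0 ∧
    ∃ e : Basis (Fin d × Fin k) ℂ V, ∀ p, e p = (T ^ (p.1 : ℕ) * N ^ (p.2 : ℕ)) v

/-- `V` is not the direct sum of two nonzero subspaces that are stable under `S`, `T` and `N`. -/
def IsIndecomposable (S T N : End ℂ V) : Prop :=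
  ∀ W₁ W₂ : Submodule ℂ V, IsCompl W₁ W₂ →
    (∀ x ∈ W₁, S x ∈ W₁ ∧ T x ∈ W₁ ∧ N x ∈ W₁) →
    (∀ x ∈ W₂, S x ∈ W₂ ∧ T x ∈ W₂ ∧ N x ∈ W₂) → W₁ = ⊥ ∨ W₂ = ⊥

theorem comm_pow {S T : End ℂ V} {ζ : ℂ} (h : S * T = ζ • (T * S)) (i : ℕ) :
    S * T ^ i = ζ ^ i • (T ^ i * S) := by
  induction i with
  | zero => simp
  | succ i ih =>
    rw [pow_succ, ← mul_assoc, ih, smul_mul_assoc, mul_assoc, h, mul_smul_comm, smul_smul,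
      ← pow_succ, mul_assoc]

theorem eigen_apply {S T N : End ℂ V} {ζ α : ℂ} (h : S * T = ζ • (T * S)) (hsn : Commute S N)
    {v : V} (hv : S v = α • v) (i j : ℕ) :
    S ((T ^ i * N ^ j) v) = (α * ζ ^ i) • (T ^ i * N ^ j) v := by
  rw [← Module.End.mul_apply, ← mul_assoc, comm_pow h, smul_mul_assoc, mul_assoc,
    (hsn.pow_right j).eq]
  simp [hv, smul_smul, mul_comm]

/-- The parameters fix the matrices of `S`, `T`, `N` in the model basis, so matching the two bases
intertwines them. The ends of the ranges use `T ^ d = b` and `N ^ k v = 0`. -/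
theorem IsModel.exists_conj {S T N : End ℂ V} {S' T' N' : End ℂ V'} {ζ α b : ℂ} {d k : ℕ}
    (h : IsModel S T N ζ α b d k) (h' : IsModel S' T' N' ζ α b d k) :
    ∃ g : V ≃ₗ[ℂ] V', ∀ x, g (S x) = S' (g x) ∧ g (T x) = T' (g x) ∧ g (N x) = N' (g x) := by
  obtain ⟨v, hv, hk, e, he⟩ := h.exists_basis
  obtain ⟨v', hv', hk', e', he'⟩ := h'.exists_basis
  let g := e.equiv e' (Equiv.refl _)
  have hg : ∀ p : Fin d × Fin k, g ((T ^ (p.1 : ℕ) * N ^ (p.2 : ℕ)) v)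
      = (T' ^ (p.1 : ℕ) * N' ^ (p.2 : ℕ)) v' := by
    intro p
    rw [← he, ← he']; simp [g]
  have hS : g.toLinearMap ∘ₗ S = S' ∘ₗ g.toLinearMap := by
    refine e.ext fun p => ?_
    simp only [LinearMap.comp_apply, LinearEquiv.coe_coe, he]
    rw [eigen_apply h.comm_st h.comm_sn hv, map_smul, hg,
      eigen_apply h'.comm_st h'.comm_sn hv']
  have hT : g.toLinearMap ∘ₗ T = T' ∘ₗ g.toLinearMap := by
    refine e.ext fun p => ?_
    simp only [LinearMap.comp_apply, LinearEquiv.coe_coe, he]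
    rw [hg, ← Module.End.mul_apply, ← Module.End.mul_apply, ← mul_assoc, ← mul_assoc, ← pow_succ',
      ← pow_succ']
    rcases Nat.lt_or_ge ((p.1 : ℕ) + 1) d with hp | hp
    · exact hg (⟨_, hp⟩, p.2)
    · have hd : (p.1 : ℕ) + 1 = d := by omega
      have h0 := hg (⟨0, by omega⟩, p.2)
      simp only [pow_zero, one_mul] at h0
      rw [hd, h.pow_t, h'.pow_t]
      simp [h0]
  have hN : g.toLinearMap ∘ₗ N = N' ∘ₗ g.toLinearMap := by
    refine e.ext fun p => ?_
    simp only [LinearMap.comp_apply, LinearEquiv.coe_coe, he]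
    rw [hg, ← Module.End.mul_apply, ← Module.End.mul_apply, ← mul_assoc, ← mul_assoc,
      ← (h.comm_tn.pow_left _).eq, ← (h'.comm_tn.pow_left _).eq, mul_assoc, mul_assoc, ← pow_succ',
      ← pow_succ']
    rcases Nat.lt_or_ge ((p.2 : ℕ) + 1) k with hp | hp
    · exact hg (p.1, ⟨_, hp⟩)
    · have hd : (p.2 : ℕ) + 1 = k := by omega
      rw [hd]
      simp [hk, hk']
  exact ⟨g, fun x => ⟨LinearMap.congr_fun hS x, LinearMap.congr_fun hT x,
    LinearMap.congr_fun hN x⟩⟩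

theorem IsModel.smul {S T N : End ℂ V} {ζ α b : ℂ} {d k : ℕ} (h : IsModel S T N ζ α b d k)
    (x : ℂ) {y : ℂ} (hy : y ≠ 0) : IsModel (x • S) (y • T) N ζ (x * α) (y ^ d * b) d k where
  comm_st := by
    simp only [smul_mul_assoc, mul_smul_comm, h.comm_st, smul_smul]
    congr 1; ring
  comm_sn := h.comm_sn.smul_left x
  comm_tn := h.comm_tn.smul_left y
  pow_t := by rw [smul_pow, h.pow_t, smul_smul]
  exists_basis := by
    obtain ⟨v, hv, hk, e, he⟩ := h.exists_basis
    refine ⟨v, by simp [hv, smul_smul], hk,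
      e.unitsSMul fun p => (Units.mk0 y hy) ^ (p.1 : ℕ), fun p => ?_⟩
    rw [Basis.unitsSMul_apply, he, smul_pow]
    simp [Units.smul_def]

theorem IsModel.pow_eq_zero {S T N : End ℂ V} {ζ α b : ℂ} {d k : ℕ}
    (h : IsModel S T N ζ α b d k) : N ^ k = 0 := by
  obtain ⟨v, hv, hk, e, he⟩ := h.exists_basis
  refine e.ext fun p => ?_
  rw [he, ← Module.End.mul_apply, ← mul_assoc,
    ← ((h.comm_tn.pow_left _).pow_right _).eq, mul_assoc,
    ← pow_add, add_comm, pow_add]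
  simp [hk]

theorem IsModel.pow_s [FiniteDimensional ℂ V] {S T N : End ℂ V} {ζ α b : ℂ} {d k : ℕ}
    (h : IsModel S T N ζ α b d k) (hζ : ζ ^ d = 1) : S ^ d = α ^ d • (1 : End ℂ V) := by
  obtain ⟨v, hv, hk, e, he⟩ := h.exists_basis
  refine e.ext fun p => ?_
  rw [he]
  have := Module.End.HasEigenvector.pow_apply (f := S) (μ := α * ζ ^ (p.1 : ℕ))
    (v := (T ^ (p.1 : ℕ) * N ^ (p.2 : ℕ)) v) ⟨by
      rw [Module.End.mem_eigenspace_iff]; exact eigen_apply h.comm_st h.comm_sn hv _ _, by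
      rw [← he]; exact e.ne_zero p⟩ d
  rw [this, mul_pow, ← pow_mul, mul_comm (p.1 : ℕ), pow_mul, hζ]
  simp

/-- The `α`-eigenspace of `S` is spanned by the `N ^ j v`, as `ζ` is primitive. Hence `g v = P v`
with `P` a polynomial in `N`, and `g = P` because both commute with `T` and `N`. Removing the
constant term `l` leaves a nilpotent operator, which is also semisimple since `g ^ q` is a nonzero
scalar; so it vanishes. -/
theorem IsModel.eq_smul_one [FiniteDimensional ℂ V] {S T N : End ℂ V} {ζ α b : ℂ} {d k : ℕ}
    (h : IsModel S T N ζ α b d k) (hζ : IsPrimitiveRoot ζ d) (hα : α ≠ 0) {g : End ℂ V}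
    (hs : Commute g S) (ht : Commute g T) (hn : Commute g N) {q : ℕ} (hq : q ≠ 0) {c : ℂ}
    (hc : c ≠ 0) (hg : g ^ q = c • (1 : End ℂ V)) : ∃ l : ℂ, g = l • (1 : End ℂ V) := by
  obtain ⟨v, hv, hk, e, he⟩ := h.exists_basis
  rcases isEmpty_or_nonempty (Fin d × Fin k) with hE | ⟨⟨i₀, j₀⟩⟩
  · exact ⟨0, e.ext fun p => (hE.false p).elim⟩
  have hd : 0 < d := i₀.pos
  have hk0 : 0 < k := j₀.pos
  have hgv : S (g v) = α • g v := by
    rw [← Module.End.mul_apply, ← hs.eq, Module.End.mul_apply, hv, map_smul]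
  have hzero : ∀ p : Fin d × Fin k, p.1 ≠ ⟨0, hd⟩ → e.repr (g v) p = 0 := by
    -- Comparing coordinates in `S (g v) = α g v` leaves only those with `ζ ^ i = 1`, that is `i =
    -- 0`.
    intro p hp
    have h1 : S (g v) = ∑ p, (α * ζ ^ (p.1 : ℕ) * e.repr (g v) p) • e p := by
      conv_lhs => rw [← e.sum_repr (g v)]
      rw [map_sum]
      refine Finset.sum_congr rfl fun p _ => ?_
      rw [map_smul, he, eigen_apply h.comm_st h.comm_sn hv, smul_smul, mul_comm]
    have h2 : e.repr (S (g v)) p = α * ζ ^ (p.1 : ℕ) * e.repr (g v) p := by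
      rw [h1, e.repr_sum_self]
    rw [hgv, map_smul, Finsupp.smul_apply, smul_eq_mul, mul_assoc] at h2
    have h3 := mul_left_cancel₀ hα h2
    have h4 : ζ ^ (p.1 : ℕ) ≠ 1 := by
      intro h5
      have := (hζ.pow_eq_one_iff_dvd _).1 h5
      exact hp (Fin.ext (Nat.eq_zero_of_dvd_of_lt this p.1.2))
    have h5 : (ζ ^ (p.1 : ℕ) - 1) * e.repr (g v) p = 0 := by rw [sub_mul, ← h3, one_mul, sub_self]
    exact (mul_eq_zero.1 h5).resolve_left (sub_ne_zero.2 h4)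
  let P : End ℂ V := ∑ j : Fin k, e.repr (g v) (⟨0, hd⟩, j) • N ^ (j : ℕ)
  have hPv : g v = P v := by
    conv_lhs => rw [← e.sum_repr (g v)]
    rw [Fintype.sum_prod_type, Finset.sum_eq_single_of_mem ⟨0, hd⟩ (Finset.mem_univ _)]
    · simp [P, he, LinearMap.sum_apply]
    · intro i _ hi
      exact Finset.sum_eq_zero fun j _ => by rw [hzero (i, j) hi, zero_smul]
  have hPN : Commute P N := by
    refine Commute.sum_left _ _ _ fun j _ => ?_
    exact ((Commute.refl N).pow_left _).smul_left _
  have hPT : Commute P T := by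
    refine Commute.sum_left _ _ _ fun j _ => ?_
    exact (h.comm_tn.symm.pow_left _).smul_left _
  have hP : g = P := by
    refine e.ext fun p => ?_
    rw [he, ← Module.End.mul_apply, ← Module.End.mul_apply,
      ((ht.pow_right (p.1 : ℕ)).mul_right (hn.pow_right (p.2 : ℕ))).eq,
      ((hPT.pow_right (p.1 : ℕ)).mul_right (hPN.pow_right (p.2 : ℕ))).eq]
    simp [hPv]
  let l := e.repr (g v) (⟨0, hd⟩, ⟨0, hk0⟩)
  refine ⟨l, ?_⟩
  have hnil : IsNilpotent (g - l • (1 : End ℂ V)) := by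
    have hN : IsNilpotent N := ⟨k, h.pow_eq_zero⟩
    have hsum : g - l • (1 : End ℂ V) =
        ∑ j ∈ Finset.univ.erase (⟨0, hk0⟩ : Fin k), e.repr (g v) (⟨0, hd⟩, j) • N ^ (j : ℕ) := by
      have h6 := Finset.sum_erase_add Finset.univ
        (fun j : Fin k => e.repr (g v) (⟨0, hd⟩, j) • N ^ (j : ℕ)) (Finset.mem_univ ⟨0, hk0⟩)
      simp only [pow_zero] at h6
      rw [sub_eq_iff_eq_add]
      exact hP.trans h6.symm
    rw [hsum]
    -- A polynomial in `N` without constant term is `N` times something commuting with `N`, hence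
    -- nilpotent.
    have hmem : ∀ A : Finset (Fin k), (∀ j ∈ A, (j : ℕ) ≠ 0) →
        ∃ M : End ℂ V, Commute N M ∧ ∑ j ∈ A, e.repr (g v) (⟨0, hd⟩, j) • N ^ (j : ℕ) = N * M := by
      intro A hA
      refine ⟨∑ j ∈ A, e.repr (g v) (⟨0, hd⟩, j) • N ^ ((j : ℕ) - 1), ?_, ?_⟩
      · refine Commute.sum_right _ _ _ fun j _ => ?_
        exact ((Commute.refl N).pow_right _).smul_right _
      · rw [Finset.mul_sum]
        refine Finset.sum_congr rfl fun j hj => ?_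
        rw [mul_smul_comm, ← pow_succ', Nat.sub_add_cancel (Nat.pos_of_ne_zero (hA j hj))]
    obtain ⟨M, hM, hM'⟩ := hmem (Finset.univ.erase ⟨0, hk0⟩) (by
      intro j hj h0
      exact (Finset.mem_erase.1 hj).1 (Fin.ext h0))
    rw [hM']
    exact hM.isNilpotent_mul_right hN
  have hss : g.IsSemisimple := by
    have : NeZero (q : ℂ) := ⟨by exact_mod_cast hq⟩
    refine Module.End.isSemisimple_of_squarefree_aeval_eq_zero
      (p := Polynomial.X ^ q - Polynomial.C c)
      (Polynomial.separable_X_pow_sub_C c (by exact_mod_cast hq) hc).squarefree ?_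
    simp [hg, Algebra.algebraMap_eq_smul_one]
  have hss' : (g - l • (1 : End ℂ V)).IsSemisimple := by
    rw [← Algebra.algebraMap_eq_smul_one]
    exact Module.End.isSemisimple_sub_algebraMap_iff.2 hss
  exact sub_eq_zero.1 (Module.End.eq_zero_of_isNilpotent_isSemisimple hnil hss')

end CommutingPair

/-! ### Models: existence, and splitting a model off a representation. -/

namespace CommutingPair

open Module

variable {V : Type*} [AddCommGroup V] [Module ℂ V]

/-- `S` is the clock matrix and `T` the cyclic shift on the first index (addition in `Fin d` wraps
around), while `N` is a Jordan block on the second index. -/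
theorem exists_isModel {d k : ℕ} (hd : 0 < d) (hk : 0 < k) {ζ : ℂ} (hζ : ζ ^ d = 1)
    (e : Basis (Fin d × Fin k) ℂ V) : ∃ S T N : End ℂ V, IsModel S T N ζ 1 1 d k := by
  have : NeZero d := ⟨hd.ne'⟩
  let S : End ℂ V := e.constr ℂ fun p => ζ ^ (p.1 : ℕ) • e p
  let T : End ℂ V := e.constr ℂ fun p => e (p.1 + 1, p.2)
  let N : End ℂ V := e.constr ℂ fun p =>
    if h : (p.2 : ℕ) + 1 < k then e (p.1, ⟨p.2 + 1, h⟩) else 0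
  have hS : ∀ p, S (e p) = ζ ^ (p.1 : ℕ) • e p := fun p => e.constr_basis _ _ p
  have hT : ∀ p, T (e p) = e (p.1 + 1, p.2) := fun p => e.constr_basis _ _ p
  have hN : ∀ p, N (e p) = if h : (p.2 : ℕ) + 1 < k then e (p.1, ⟨p.2 + 1, h⟩) else 0 :=
    fun p => e.constr_basis _ _ p
  have hTi : ∀ (i : ℕ) (q : Fin d × Fin k), (T ^ i) (e q) = e (q.1 + Fin.ofNat d i, q.2) := by
    intro i q
    induction i with
    | zero =>
      refine congrArg e (Prod.ext (Fin.ext ?_) rfl)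
      simp
    | succ i ih =>
      rw [pow_succ', Module.End.mul_apply, ih, hT]
      refine congrArg e (Prod.ext (Fin.ext ?_) rfl)
      simp [Fin.val_add, add_assoc]
  have hNj : ∀ (i : Fin d) (j : ℕ), (N ^ j) (e (i, ⟨0, hk⟩)) =
      if h : j < k then e (i, ⟨j, h⟩) else 0 := by
    intro i j
    induction j with
    | zero => simp [hk]
    | succ j ih =>
      rw [pow_succ', Module.End.mul_apply, ih]
      by_cases h : j + 1 < k
      · rw [dif_pos (by omega), hN]
      · rw [dif_neg h]
        split_ifs with h'
        · rw [hN, dif_neg h]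
        · simp
  refine ⟨S, T, N, ?_, ?_, ?_, ?_, e (⟨0, hd⟩, ⟨0, hk⟩), ?_, ?_, e, ?_⟩
  · refine e.ext fun p => ?_
    simp only [Module.End.mul_apply, LinearMap.smul_apply, hS, hT, map_smul, smul_smul]
    congr 1
    rw [Fin.val_add, ← pow_succ']
    conv_rhs => rw [← Nat.mod_add_div ((p.1 : ℕ) + 1) d, pow_add, pow_mul, hζ, one_pow, mul_one]
    simp
  · refine e.ext fun p => ?_
    simp only [Module.End.mul_apply, hS, hN, map_smul]
    split_ifs with h
    · rw [hS]
    · simp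
  · refine e.ext fun p => ?_
    simp only [Module.End.mul_apply, hT, hN]
    split_ifs with h
    · rw [hT]
    · simp
  · refine e.ext fun p => ?_
    rw [hTi, one_smul, Module.End.one_apply]
    refine congrArg e (Prod.ext (Fin.ext ?_) rfl)
    simp
  · rw [hS]; simp
  · rw [hNj, dif_neg (lt_irrefl k)]
  · intro p
    rw [Module.End.mul_apply, hNj, dif_pos p.2.2, hTi]
    congr 1
    refine Prod.ext (Fin.ext ?_) rfl
    simp

/-- The projection onto the `α`-eigenspace of `S`, if `S ^ d = α ^ d`. -/
theorem exists_eigenprojection {S N : End ℂ V} {α : ℂ} {d : ℕ} (hd : 0 < d) (hα : α ≠ 0)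
    (hS : S ^ d = α ^ d • (1 : End ℂ V)) (hsn : Commute S N) :
    ∃ P : End ℂ V, (∀ x, S (P x) = α • P x) ∧ (∀ x, P (S x) = α • P x) ∧
      (∀ x, S x = α • x → P x = x) ∧ Commute P N := by
  -- The average over the powers of `α⁻¹ S`, whose `d`-th power is `1`.
  let P : End ℂ V := (d : ℂ)⁻¹ • ∑ r ∈ Finset.range d, (α⁻¹ • S) ^ r
  have h1 : (α⁻¹ • S) ^ d = 1 := by
    rw [smul_pow, hS, smul_smul, ← mul_pow, inv_mul_cancel₀ hα, one_pow, one_smul]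
  have h2 : (α⁻¹ • S) * P = P := by
    have := mul_neg_geom_sum (α⁻¹ • S) d
    rw [h1, sub_self, sub_mul, one_mul, sub_eq_zero] at this
    simp only [P]
    rw [mul_smul_comm, ← this]
  have h3 : P * (α⁻¹ • S) = P := by
    have := geom_sum_mul_neg (α⁻¹ • S) d
    rw [h1, sub_self, mul_sub, mul_one, sub_eq_zero] at this
    simp only [P]
    rw [smul_mul_assoc, ← this]
  refine ⟨P, fun x => ?_, fun x => ?_, fun x hx => ?_, ?_⟩
  · have := LinearMap.congr_fun h2 x
    conv_rhs => rw [← this]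
    simp [smul_smul, hα]
  · have := LinearMap.congr_fun h3 x
    conv_rhs => rw [← this]
    simp [smul_smul, hα]
  · have h4 : ∀ r : ℕ, ((α⁻¹ • S) ^ r) x = x := by
      intro r
      induction r with
      | zero => simp
      | succ r ih => rw [pow_succ, Module.End.mul_apply]; simp [hx, smul_smul, hα, ih]
    have hd' : (d : ℂ) ≠ 0 := by exact_mod_cast hd.ne'
    simp [P, LinearMap.sum_apply, h4, ← Nat.cast_smul_eq_nsmul ℂ, smul_smul, hd']
  · exact (Commute.sum_left _ _ _ fun r _ => (hsn.smul_left _).pow_left r).smul_left _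

/-- Let `k` be maximal with `N ^ k` nonzero on the `α`-eigenspace of `S`; choose `v` there and a
functional `l` with `l ∘ S = α l` and `l (N ^ k v) ≠ 0`. The vectors `T ^ i N ^ j v` and the
functionals `l ∘ T ^ i N ^ j` pair nondegenerately, so the span of the former and the common kernel
of the latter are stable complements. Indecomposability kills the kernel. -/
theorem exists_isModel_of_isIndecomposable [FiniteDimensional ℂ V] [Nontrivial V]
    {S T N : End ℂ V} {ζ a b : ℂ} {d : ℕ} (hd : 0 < d) (hζ : IsPrimitiveRoot ζ d)
    (hst : S * T = ζ • (T * S)) (hsn : Commute S N) (htn : Commute T N) (hN : IsNilpotent N)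
    (ha : a ≠ 0) (hb : b ≠ 0) (hS : S ^ d = a • (1 : End ℂ V)) (hT : T ^ d = b • (1 : End ℂ V))
    (hind : IsIndecomposable S T N) :
    ∃ (α : ℂ) (k : ℕ), α ≠ 0 ∧ IsModel S T N ζ α b d k := by
  classical
  obtain ⟨α, hα⟩ := Module.End.exists_eigenvalue S
  obtain ⟨v₀, hv₀⟩ := hα.exists_hasEigenvector
  have hαd : α ^ d = a := by
    have := hv₀.pow_apply d
    rw [hS] at this
    exact (smul_left_injective ℂ hv₀.2 this).symm
  have hα0 : α ≠ 0 := by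
    rintro rfl
    rw [zero_pow hd.ne'] at hαd
    exact ha hαd.symm
  have hSα : S ^ d = α ^ d • (1 : End ℂ V) := by rw [hαd, hS]
  have hex : ∃ k, ∀ x, S x = α • x → (N ^ k) x = 0 := by
    obtain ⟨k, hk⟩ := hN
    exact ⟨k, fun x _ => by rw [hk]; rfl⟩
  -- Here `k` is the last exponent with `N ^ k` nonzero on the eigenspace, so the model below has
  -- length `k + 1`.
  obtain ⟨k, hk, hkmin⟩ : ∃ k, (∀ x, S x = α • x → (N ^ (k + 1)) x = 0) ∧
      ∃ x, S x = α • x ∧ (N ^ k) x ≠ 0 := by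
    have hpos : Nat.find hex ≠ 0 := by
      intro h0
      have := Nat.find_spec hex
      rw [h0] at this
      exact hv₀.2 (this v₀ hv₀.apply_eq_smul)
    refine ⟨Nat.find hex - 1, ?_, ?_⟩
    · rw [Nat.sub_add_cancel (Nat.pos_of_ne_zero hpos)]
      exact Nat.find_spec hex
    · have := Nat.find_min hex (Nat.sub_lt (Nat.pos_of_ne_zero hpos) one_pos)
      push Not at this
      exact this
  obtain ⟨v, hv, hkv⟩ := hkmin
  obtain ⟨P, hSP, hPS, hP1, hPN⟩ := exists_eigenprojection hd hα0 hSα hsn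
  obtain ⟨l₀, hl₀⟩ : ∃ l₀ : Dual ℂ V, l₀ ((N ^ k) v) ≠ 0 := by
    by_contra! hcon
    exact hkv ((Module.forall_dual_apply_eq_zero_iff ℂ _).1 hcon)
  let l : Dual ℂ V := l₀ ∘ₗ P
  have hlS : ∀ x, l (S x) = α * l x := fun x => by simp [l, hPS]
  have heig : ∀ i j : ℕ, S ((T ^ i * N ^ j) v) = (α * ζ ^ i) • (T ^ i * N ^ j) v :=
    fun i j => eigen_apply hst hsn hv i j
  have hlN : ∀ (j : ℕ) (x : V), k < j → l ((N ^ j) x) = 0 := by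
    intro j x hj
    have h1 : P ((N ^ j) x) = (N ^ j) (P x) := LinearMap.congr_fun (hPN.pow_right j).eq x
    have h2 : (N ^ j) (P x) = 0 := by
      obtain ⟨c, rfl⟩ := Nat.exists_eq_add_of_lt hj
      rw [show k + c + 1 = c + (k + 1) by ring, pow_add, Module.End.mul_apply, hk _ (hSP x),
        map_zero]
    simp [l, h1, h2]
  have hlk : l ((N ^ k) v) ≠ 0 := by
    have : P ((N ^ k) v) = (N ^ k) v := hP1 _ (by
      rw [← Module.End.mul_apply, (hsn.pow_right k).eq, Module.End.mul_apply, hv, map_smul])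
    simpa [l, this] using hl₀
  have hlT : ∀ i j : ℕ, ¬ d ∣ i → l ((T ^ i * N ^ j) v) = 0 := by
    intro i j hi
    have h1 := hlS ((T ^ i * N ^ j) v)
    rw [heig i j, map_smul, smul_eq_mul, mul_assoc] at h1
    have h2 := mul_left_cancel₀ hα0 h1
    have h3 : ζ ^ i ≠ 1 := fun h => hi ((hζ.pow_eq_one_iff_dvd i).1 h)
    have h4 : (ζ ^ i - 1) * l ((T ^ i * N ^ j) v) = 0 := by rw [sub_mul, h2, one_mul, sub_self]
    exact (mul_eq_zero.1 h4).resolve_left (sub_ne_zero.2 h3)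
  let w : Fin d × Fin (k + 1) → V := fun p => (T ^ (p.1 : ℕ) * N ^ (p.2 : ℕ)) v
  let L : V →ₗ[ℂ] (Fin d × Fin (k + 1) → ℂ) :=
    LinearMap.pi fun p => l ∘ₗ (T ^ (p.1 : ℕ) * N ^ (p.2 : ℕ))
  have hLapp : ∀ x p, L x p = l ((T ^ (p.1 : ℕ) * N ^ (p.2 : ℕ)) x) := fun x p => rfl
  let B : (Fin d × Fin (k + 1) → ℂ) →ₗ[ℂ] V := Fintype.linearCombination ℂ w
  have hBapp : ∀ c, B c = ∑ p, c p • w p := fun c => Fintype.linearCombination_apply ℂ w c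
  have hTT : ∀ i j i' j' : ℕ, (T ^ i * N ^ j) ((T ^ i' * N ^ j') v) =
      (T ^ (i + i') * N ^ (j + j')) v := by
    intro i j i' j'
    rw [← Module.End.mul_apply, mul_assoc, ← mul_assoc (N ^ j),
      ← ((htn.pow_left i').pow_right j).eq, mul_assoc, ← pow_add, ← mul_assoc, ← pow_add]
  have hinj : ∀ c, L (B c) = 0 → c = 0 := by
    intro c hc
    -- Induction on `j`. To isolate the coefficient at `(i, j')`, evaluate the functional with index
    -- `(i', k - j')`, where `i' ≡ -i` modulo `d`: smaller second indices vanish by induction,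
    -- larger ones by `hlN`, and other first indices by `hlT`.
    have key : ∀ j : ℕ, ∀ p : Fin d × Fin (k + 1), (p.2 : ℕ) = j → c p = 0 := by
      intro j
      induction j using Nat.strong_induction_on with
      | _ j ih =>
        rintro ⟨i, j'⟩ rfl
        dsimp only at ih
        have hi : ∃ i' : Fin d, d ∣ (i' : ℕ) + i ∧ ∀ i'' : Fin d, d ∣ (i' : ℕ) + i'' → i'' = i := by
          have hmod : ∃ r : ℕ, r < d ∧ d ∣ r + i := by
            rcases Nat.eq_zero_or_pos (i : ℕ) with h0 | h0
            · exact ⟨0, hd, by simp [h0]⟩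
            · exact ⟨d - i, by omega, by rw [Nat.sub_add_cancel i.2.le]⟩
          obtain ⟨r, hr, hdr⟩ := hmod
          refine ⟨⟨r, hr⟩, hdr, fun i'' h'' => Fin.ext ?_⟩
          have : (r + i'') ≡ (r + i) [MOD d] :=
            ((Nat.modEq_zero_iff_dvd.2 h'').trans (Nat.modEq_zero_iff_dvd.2 hdr).symm)
          exact Nat.ModEq.eq_of_lt_of_lt (Nat.ModEq.add_left_cancel' r this) i''.2 i.2
        obtain ⟨i', hi'd, hi'⟩ := hi
        have h1 : L (B c) (i', ⟨k - j', by omega⟩) = 0 := by rw [hc]; rfl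
        rw [hLapp, hBapp, map_sum, map_sum, Finset.sum_eq_single_of_mem (i, j')
          (Finset.mem_univ _)] at h1
        · simp only [w, map_smul, hTT] at h1
          rw [Nat.sub_add_cancel (by omega)] at h1
          obtain ⟨q, hq⟩ := hi'd
          rw [hq, pow_mul, hT, smul_pow, one_pow] at h1
          simp [hb, hlk] at h1
          exact h1
        · rintro ⟨i'', j''⟩ - hne
          simp only [w, map_smul, hTT]
          by_cases hdd : d ∣ (i' : ℕ) + i''
          · have := hi' i'' hdd
            subst this
            rcases Nat.lt_trichotomy (j'' : ℕ) j' with hlt | heq | hgt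
            · rw [ih j'' hlt (i'', j'') rfl, zero_smul]
            · exact (hne (by rw [Fin.ext heq])).elim
            · obtain ⟨q, hq⟩ := hdd
              rw [hq, pow_mul, hT, smul_pow, one_pow, smul_mul_assoc, one_mul,
                LinearMap.smul_apply, map_smul, hlN _ _ (by omega), smul_zero, smul_zero]
          · rw [hlT _ _ hdd, smul_zero]
    exact funext fun p => key _ p rfl
  have hLB : Function.Injective (L ∘ₗ B) := by
    rw [← LinearMap.ker_eq_bot, LinearMap.ker_eq_bot']
    exact hinj
  have hLB' : Function.Surjective (L ∘ₗ B) := LinearMap.injective_iff_surjective.1 hLB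
  have hcompl : IsCompl (LinearMap.range B) (LinearMap.ker L) := by
    constructor
    · rw [Submodule.disjoint_def]
      rintro _ ⟨c, rfl⟩ hx
      rw [hinj c hx, map_zero]
    · rw [codisjoint_iff, eq_top_iff]
      intro x _
      obtain ⟨c, hc⟩ := hLB' (L x)
      rw [Submodule.mem_sup]
      refine ⟨B c, ⟨c, rfl⟩, x - B c, ?_, by abel⟩
      rw [LinearMap.mem_ker, map_sub, sub_eq_zero]
      exact hc.symm
  have hmem : ∀ i j : ℕ, (T ^ i * N ^ j) v ∈ LinearMap.range B := by
    intro i j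
    rcases Nat.lt_or_ge j (k + 1) with hj | hj
    · rw [← Nat.mod_add_div i d, pow_add, pow_mul, hT, smul_pow, one_pow, mul_smul_comm, mul_one,
        smul_mul_assoc, LinearMap.smul_apply]
      refine Submodule.smul_mem _ _ ⟨Pi.single (⟨i % d, Nat.mod_lt _ hd⟩, ⟨j, hj⟩) 1, ?_⟩
      rw [hBapp]
      simp [Pi.single_apply, w]
    · obtain ⟨c, rfl⟩ := Nat.exists_eq_add_of_le' hj
      rw [pow_add, Module.End.mul_apply, Module.End.mul_apply, hk v hv]
      simp
  have hB : ∀ (f : End ℂ V), (∀ p, f (w p) ∈ LinearMap.range B) →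
      ∀ x ∈ LinearMap.range B, f x ∈ LinearMap.range B := by
    rintro f hf _ ⟨c, rfl⟩
    rw [hBapp, map_sum]
    exact Submodule.sum_mem _ fun p _ => by
      rw [map_smul]; exact Submodule.smul_mem _ _ (hf p)
  have hker : ∀ x ∈ LinearMap.ker L, ∀ i j : ℕ, l ((T ^ i * N ^ j) x) = 0 := by
    intro x hx i j
    rcases Nat.lt_or_ge j (k + 1) with hj | hj
    · rw [← Nat.mod_add_div i d, pow_add, pow_mul, hT, smul_pow, one_pow, mul_smul_comm, mul_one,
        smul_mul_assoc, LinearMap.smul_apply, map_smul]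
      have := congrFun (LinearMap.mem_ker.1 hx) (⟨i % d, Nat.mod_lt _ hd⟩, ⟨j, hj⟩)
      rw [hLapp] at this
      rw [this]; simp
    · rw [((htn.pow_left i).pow_right j).eq, Module.End.mul_apply]
      exact hlN _ _ hj
  have hW := hind _ _ hcompl (fun x hx => ⟨hB S (fun p => ?_) x hx, hB T (fun p => ?_) x hx,
    hB N (fun p => ?_) x hx⟩) (fun x hx => ⟨?_, ?_, ?_⟩)
  · have hker' : LinearMap.ker L = ⊥ := by
      refine hW.resolve_left fun h => ?_
      have := hmem 0 k
      rw [h, Submodule.mem_bot] at this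
      exact hkv (by simpa using this)
    have hrange : LinearMap.range B = ⊤ := by
      have := hcompl.sup_eq_top
      rwa [hker', sup_bot_eq] at this
    have hBinj : Function.Injective B := by
      have : Function.Injective (L ∘ B) := hLB
      exact this.of_comp
    let E := LinearEquiv.ofBijective B ⟨hBinj, LinearMap.range_eq_top.1 hrange⟩
    refine ⟨α, k + 1, hα0, hst, hsn, htn, hT, v, hv, hk v hv,
      (Pi.basisFun ℂ (Fin d × Fin (k + 1))).map E, fun p => ?_⟩
    simp only [Basis.map_apply, Pi.basisFun_apply]
    change B (Pi.single p 1) = _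
    rw [hBapp]
    simp [Pi.single_apply, w]
  · rw [heig _ _]; exact Submodule.smul_mem _ _ (hmem _ _)
  · have := hTT 1 0 p.1 p.2
    simp only [pow_one, pow_zero, mul_one] at this
    simp only [w, this]; exact hmem _ _
  · have := hTT 0 1 p.1 p.2
    simp only [pow_one, pow_zero, one_mul] at this
    simp only [w, this]; exact hmem _ _
  · refine funext fun p => ?_
    rw [hLapp]
    have h1 := comm_pow hst p.1
    have hζ0 : ζ ^ (p.1 : ℕ) ≠ 0 := pow_ne_zero _ (hζ.ne_zero hd.ne')
    have h2 : S ((T ^ (p.1 : ℕ) * N ^ (p.2 : ℕ)) x) =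
        ζ ^ (p.1 : ℕ) • (T ^ (p.1 : ℕ) * N ^ (p.2 : ℕ)) (S x) := by
      rw [← Module.End.mul_apply, ← mul_assoc, h1, smul_mul_assoc, mul_assoc,
        (hsn.pow_right _).eq]
      simp
    have h3 := hlS ((T ^ (p.1 : ℕ) * N ^ (p.2 : ℕ)) x)
    rw [hker x hx, h2, map_smul, mul_zero, smul_eq_mul] at h3
    exact (mul_eq_zero.1 h3).resolve_left hζ0
  · refine funext fun p => ?_
    rw [hLapp, ← Module.End.mul_apply, mul_assoc, ← (htn.pow_right _).eq, ← mul_assoc, ← pow_succ]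
    exact hker x hx _ _
  · refine funext fun p => ?_
    rw [hLapp, ← Module.End.mul_apply, mul_assoc, ← pow_succ]
    exact hker x hx _ _

end CommutingPair

/-! ### Semisimple and unipotent elements through right translation. -/

namespace AlgGrp

variable {G : Type} [Group G]

@[simp]
theorem rightTranslation_apply (g : G) (f : G → ℂ) (x : G) :
    rightTranslation g f x = f (x * g) := rfl

theorem rightTranslation_pow (g : G) (k : ℕ) :
    rightTranslation (g ^ k) = rightTranslation g ^ k := by
  induction k with
  | zero => ext f x; simp
  | succ k ih =>
    rw [pow_succ (rightTranslation g), ← ih]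
    ext f x
    simp [pow_succ, mul_assoc]

theorem IsSemisimpleElt.pow {A : Subalgebra ℂ (G → ℂ)} {g : G} (h : IsSemisimpleElt A g) (k : ℕ) :
    IsSemisimpleElt A (g ^ k) := by
  refine h.trans (iSup_le fun c => le_trans ?_ (le_iSup _ (c ^ k)))
  refine inf_le_inf_right _ fun f hf => ?_
  rw [Module.End.mem_eigenspace_iff] at hf ⊢
  rw [rightTranslation_pow]
  induction k with
  | zero => simp
  | succ k ih => rw [pow_succ', Module.End.mul_apply, ih, map_smul, hf, smul_smul, ← pow_succ]

/-- Right translation by `g` generates an action of `ℤ/N`. Fourier inversion over this group writes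
`f` as a sum of eigenfunctions lying in `A`. -/
theorem isSemisimpleElt_of_pow_eq_one {A : Subalgebra ℂ (G → ℂ)} {g : G}
    (hA : ∀ f ∈ A, rightTranslation g f ∈ A) {N : ℕ} (hN : 0 < N) (hg : g ^ N = 1) :
    IsSemisimpleElt A g := by
  intro f hf
  obtain ⟨η, hη⟩ : ∃ η : ℂ, IsPrimitiveRoot η N :=
    ⟨_, Complex.isPrimitiveRoot_exp N hN.ne'⟩
  have hη0 : η ≠ 0 := hη.ne_zero hN.ne'
  set R := rightTranslation g with hR
  have hRN : R ^ N = 1 := by rw [hR, ← rightTranslation_pow, hg]; ext; simp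
  let P : ℕ → G → ℂ := fun i => ∑ r ∈ Finset.range N, (η⁻¹ ^ i) ^ r • (R ^ r) f
  have hmem : ∀ r : ℕ, (R ^ r) f ∈ A := by
    intro r
    induction r with
    | zero => simpa using hf
    | succ r ih => rw [pow_succ', Module.End.mul_apply]; exact hA _ ih
  have hP : ∀ i, P i ∈ Module.End.eigenspace R (η ^ i) ⊓ Subalgebra.toSubmodule A := by
    intro i
    refine ⟨?_, Submodule.sum_mem _ fun r _ => Submodule.smul_mem _ _ (hmem r)⟩
    rw [SetLike.mem_coe, Module.End.mem_eigenspace_iff]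
    have h1 : (η⁻¹ ^ i • R) * (∑ r ∈ Finset.range N, (η⁻¹ ^ i • R) ^ r) =
        ∑ r ∈ Finset.range N, (η⁻¹ ^ i • R) ^ r := by
      have h2 := mul_neg_geom_sum (η⁻¹ ^ i • R) N
      rw [smul_pow, hRN, ← pow_mul, mul_comm i, pow_mul, hη.inv.pow_eq_one, one_pow,
        one_smul, sub_self, sub_mul, one_mul, sub_eq_zero] at h2
      exact h2.symm
    have h3 : (∑ r ∈ Finset.range N, (η⁻¹ ^ i • R) ^ r) f = P i := by
      simp [P, LinearMap.sum_apply, smul_pow]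
    have h4 := LinearMap.congr_fun h1 f
    rw [Module.End.mul_apply, h3, LinearMap.smul_apply] at h4
    conv_rhs => rw [← h4]
    rw [smul_smul, ← mul_pow, mul_inv_cancel₀ hη0, one_pow, one_smul]
  have hN0 : (N : ℂ) ≠ 0 := by exact_mod_cast hN.ne'
  have hsum : f = (N : ℂ)⁻¹ • ∑ i ∈ Finset.range N, P i := by
    simp only [P]
    rw [Finset.sum_comm, Finset.sum_eq_single_of_mem 0 (Finset.mem_range.2 hN)]
    · simp [smul_smul, hN0, ← Nat.cast_smul_eq_nsmul ℂ]
    · intro r hr hr0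
      rw [← Finset.sum_smul]
      have h1 : ∑ i ∈ Finset.range N, (η⁻¹ ^ i) ^ r = 0 := by
        have hne : η⁻¹ ^ r ≠ 1 := by
          intro h
          have := (hη.inv.pow_eq_one_iff_dvd r).1 h
          exact hr0 (Nat.eq_zero_of_dvd_of_lt this (Finset.mem_range.1 hr))
        have h2 := mul_neg_geom_sum (η⁻¹ ^ r) N
        rw [← pow_mul, mul_comm r, pow_mul, hη.inv.pow_eq_one, one_pow, sub_self] at h2
        simp only [← pow_mul] at h2 ⊢
        simp only [mul_comm _ r]
        exact (mul_eq_zero.1 h2).resolve_left (sub_ne_zero.2 hne.symm)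
      rw [h1, zero_smul]
  rw [hsum]
  refine Submodule.smul_mem _ _ (Submodule.sum_mem _ fun i _ => ?_)
  exact Submodule.mem_iSup_of_mem (η ^ i) (hP i)

/-- Right translation by a semisimple element has no Jordan chain of length two on regular
functions, because generalized eigenspaces for distinct eigenvalues are independent. -/
theorem IsSemisimpleElt.eq_smul {A : Subalgebra ℂ (G → ℂ)} {g : G} (h : IsSemisimpleElt A g)
    {f : G → ℂ} (hf : f ∈ A) {c : ℂ}
    
    (h2 : ((rightTranslation g - algebraMap ℂ (Module.End ℂ (G → ℂ)) c : Module.End ℂ (G → ℂ)) ^ 2 :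
      Module.End ℂ (G → ℂ)) f = 0) : rightTranslation g f = c • f := by
  set R := rightTranslation g
  have hf' : f ∈ ⨆ a, Module.End.eigenspace R a :=
    (h.trans (iSup_mono fun _ => inf_le_left)) hf
  rw [iSup_split_single _ c, Submodule.mem_sup] at hf'
  obtain ⟨y, hy, z, hz, rfl⟩ := hf'
  have hz' : z ∈ ⨆ a, ⨆ (_ : a ≠ c), Module.End.maxGenEigenspace R a :=
    (iSup₂_mono fun a _ => Module.End.genEigenspace R a |>.monotone le_top) hz
  have hy0 : (R - algebraMap ℂ _ c) y = 0 := by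
    rw [Module.End.mem_eigenspace_iff] at hy
    simp [hy, Module.algebraMap_end_apply]
  have hzc : z ∈ Module.End.maxGenEigenspace R c := by
    rw [Module.End.mem_maxGenEigenspace]
    refine ⟨2, ?_⟩
    rw [map_add, pow_two, Module.End.mul_apply, hy0, map_zero, zero_add] at h2
    rw [pow_two, ← Algebra.algebraMap_eq_smul_one]
    exact h2
  have hz0 : z = 0 :=
    (Submodule.disjoint_def.1 (Module.End.independent_maxGenEigenspace R c)) z hzc hz'
  rw [hz0, add_zero]
  exact Module.End.mem_eigenspace_iff.1 hy

/-- With `D = R_g - 1`, the identity `D (f h) = D f * h + f * D h + D f * D h` lowers `a`, `b` or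
both in each term, so induction on `a + b` applies. -/
theorem isLocallyNilpotent_mul (g : G) (s : ℕ) : ∀ (a b : ℕ) (f h : G → ℂ), a + b = s →
    ((rightTranslation g - 1) ^ a) f = 0 → ((rightTranslation g - 1) ^ b) h = 0 →
    ((rightTranslation g - 1) ^ s) (f * h) = 0 := by
  induction s using Nat.strong_induction_on with
  | _ s ih =>
    intro a b f h hab hf hh
    rcases a with _ | a
    · rw [pow_zero, Module.End.one_apply] at hf
      simp [hf]
    rcases b with _ | b
    · rw [pow_zero, Module.End.one_apply] at hh
      simp [hh]
    set D := rightTranslation g - 1 with hD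
    have hmul : D (f * h) = D f * h + f * D h + D f * D h := by
      ext x; simp [hD]; ring
    rw [pow_succ, Module.End.mul_apply] at hf hh
    obtain ⟨s, rfl⟩ : ∃ t, s = t + 2 := ⟨a + b, by omega⟩
    have h1 := ih (s + 1) (by omega) a (b + 1) (D f) h (by omega) hf
      (by rw [pow_succ, Module.End.mul_apply]; exact hh)
    have h2 := ih (s + 1) (by omega) (a + 1) b f (D h) (by omega)
      (by rw [pow_succ, Module.End.mul_apply]; exact hf) hh
    have h3 := ih s (by omega) a b (D f) (D h) (by omega) hf hh
    rw [pow_succ, Module.End.mul_apply, hmul, map_add, map_add, h1, h2, pow_succ',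
      Module.End.mul_apply, h3]
    simp

end AlgGrp

/-! ### Reading matrix properties off regular functions on `SL_n / μ_m`. -/

namespace SLMod

open AlgGrp

variable {n m : ℕ}

theorem rightTranslation_mem (g : Grp n m) {f : Grp n m → ℂ} (hf : f ∈ regularFunctions n m) :
    rightTranslation g f ∈ regularFunctions n m := by
  obtain ⟨p, hp⟩ := hf
  induction g using QuotientGroup.induction_on with
  | H h =>
    refine ⟨MvPolynomial.bind₁ (fun ij => ∑ k, MvPolynomial.X (ij.1, k) *
      MvPolynomial.C ((h : Matrix (Fin n) (Fin n) ℂ) k ij.2)) p, fun g => ?_⟩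
    rw [rightTranslation_apply, ← QuotientGroup.mk_mul, hp]
    refine Eq.trans ?_ (MvPolynomial.eval₂Hom_bind₁ (RingHom.id ℂ) _ _ p).symm
    change MvPolynomial.eval _ p = MvPolynomial.eval _ p
    congr 2
    ext ij
    simp [Matrix.mul_apply]

/-- The regular function `g ↦ (g x)_i ^ a * (g y)_j ^ b` on `SL_n / μ_m`, where `m ∣ a + b`. -/
def monomialFun (x y : Fin n → ℂ) (i j : Fin n) {a b : ℕ} (h : m ∣ a + b) : Grp n m → ℂ :=
  fun g => Quotient.liftOn' g
    (fun g : SL(n, ℂ) => ((g : Matrix (Fin n) (Fin n) ℂ).mulVec x i) ^ a *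
      ((g : Matrix (Fin n) (Fin n) ℂ).mulVec y j) ^ b) (by
    intro g g' hg
    rw [QuotientGroup.leftRel_apply] at hg
    obtain ⟨z, hz, rfl⟩ : ∃ z ∈ mu n m, g' = g * z := ⟨g⁻¹ * g', hg, by simp⟩
    rw [← mu_comm hz]
    obtain ⟨ζ, h1, h2⟩ := hz
    have h3 : ζ ^ (a + b) = 1 := by
      obtain ⟨c, hc⟩ := h
      rw [hc, pow_mul, h1, one_pow]
    have h4 : ∀ (w : Fin n → ℂ) (i : Fin n), ((z * g : SL(n, ℂ)) :
        Matrix (Fin n) (Fin n) ℂ).mulVec w i = ζ * (g : Matrix (Fin n) (Fin n) ℂ).mulVec w i := by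
      intro w i
      rw [Matrix.SpecialLinearGroup.coe_mul, h2, ← Matrix.mulVec_mulVec, Matrix.scalar_apply,
        Matrix.mulVec_diagonal]
    simp only [h4]
    rw [mul_pow, mul_pow, mul_mul_mul_comm, ← pow_add, h3, one_mul])

theorem monomialFun_mk (x y : Fin n → ℂ) (i j : Fin n) {a b : ℕ} (h : m ∣ a + b) (g : SL(n, ℂ)) :
    monomialFun x y i j h (QuotientGroup.mk g : Grp n m) =
      ((g : Matrix (Fin n) (Fin n) ℂ).mulVec x i) ^ a *
      ((g : Matrix (Fin n) (Fin n) ℂ).mulVec y j) ^ b := rfl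

theorem monomialFun_mem (x y : Fin n → ℂ) (i j : Fin n) {a b : ℕ} (h : m ∣ a + b) :
    monomialFun x y i j h ∈ regularFunctions n m := by
  refine ⟨(∑ k, MvPolynomial.X (i, k) * MvPolynomial.C (x k)) ^ a *
    (∑ k, MvPolynomial.X (j, k) * MvPolynomial.C (y k)) ^ b, fun g => ?_⟩
  rw [monomialFun_mk]
  simp [Matrix.mulVec, dotProduct]

theorem rightTranslation_monomialFun (x y : Fin n → ℂ) (i j : Fin n) {a b : ℕ} (h : m ∣ a + b)
    (g : SL(n, ℂ)) : rightTranslation (QuotientGroup.mk g : Grp n m) (monomialFun x y i j h) =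
      monomialFun ((g : Matrix (Fin n) (Fin n) ℂ).mulVec x)
        ((g : Matrix (Fin n) (Fin n) ℂ).mulVec y) i j h := by
  ext z
  induction z using QuotientGroup.induction_on with
  | H z =>
    rw [rightTranslation_apply, ← QuotientGroup.mk_mul, monomialFun_mk, monomialFun_mk]
    simp [Matrix.mulVec_mulVec]

/-- A Jordan chain `v, w` of `F` gives one of right translation: the functions `(g v)_i (g w)_i ^ (m
- 1)` and, up to a factor, `(g w)_i ^ m`. Both descend to the quotient since the total degree is
`m`. Semisimplicity makes the second vanish, and its value at `1` is `w_i ^ m`. -/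
theorem mulVec_eq_smul_of_isSemisimpleElt (hm : 0 < m) {F : SL(n, ℂ)}
    (hF : IsSemisimpleElt (regularFunctions n m) (QuotientGroup.mk F)) {c : ℂ} {v w : Fin n → ℂ}
    (hv : (F : Matrix (Fin n) (Fin n) ℂ).mulVec v = c • v + w)
    (hw : (F : Matrix (Fin n) (Fin n) ℂ).mulVec w = c • w) : w = 0 := by
  by_contra hw0
  obtain ⟨i, hi⟩ := Function.ne_iff.1 hw0
  have hc : c ≠ 0 := by
    rintro rfl
    rw [zero_smul] at hw
    exact hw0 (Matrix.eq_zero_of_mulVec_eq_zero (by rw [F.2]; exact one_ne_zero) hw)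
  have h1m : m ∣ 1 + (m - 1) := by rw [Nat.add_sub_cancel' hm]
  have hc' : c * c ^ (m - 1) = c ^ m := by rw [← pow_succ', Nat.sub_add_cancel hm]
  let f : Grp n m → ℂ := monomialFun v w i i h1m
  let g : Grp n m → ℂ := monomialFun w w i i h1m
  have hRf : rightTranslation (QuotientGroup.mk F : Grp n m) f = c ^ m • f + c ^ (m - 1) • g := by
    rw [rightTranslation_monomialFun, hv, hw]
    ext z
    induction z using QuotientGroup.induction_on with
    | H z =>
      simp only [f, g, Pi.add_apply, Pi.smul_apply, monomialFun_mk, Matrix.mulVec_add,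
        Matrix.mulVec_smul, smul_eq_mul, mul_pow, ← hc']
      ring
  have hRg : rightTranslation (QuotientGroup.mk F : Grp n m) g = c ^ m • g := by
    rw [rightTranslation_monomialFun, hw]
    ext z
    induction z using QuotientGroup.induction_on with
    | H z =>
      simp only [g, Pi.smul_apply, monomialFun_mk,
        Matrix.mulVec_smul, smul_eq_mul, mul_pow, ← hc']
      ring
  have hDf : (rightTranslation (QuotientGroup.mk F : Grp n m) -
      algebraMap ℂ (Module.End ℂ (Grp n m → ℂ)) (c ^ m)) f = c ^ (m - 1) • g := by
    rw [LinearMap.sub_apply, hRf, Module.algebraMap_end_apply, add_sub_cancel_left]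
  have hDg : (rightTranslation (QuotientGroup.mk F : Grp n m) -
      algebraMap ℂ (Module.End ℂ (Grp n m → ℂ)) (c ^ m)) g = 0 := by
    rw [LinearMap.sub_apply, hRg, Module.algebraMap_end_apply, sub_self]
  have h1 := hF.eq_smul (monomialFun_mem v w i i h1m) (c := c ^ m) (by
    rw [pow_two, Module.End.mul_apply]
    change (_ : Module.End ℂ _) ((_ : Module.End ℂ _) f) = 0
    rw [hDf, map_smul, hDg, smul_zero])
  change rightTranslation _ f = c ^ m • f at h1
  rw [hRf, add_eq_left] at h1
  have h2 := congrFun ((smul_eq_zero.1 h1).resolve_left (pow_ne_zero _ hc)) (QuotientGroup.mk 1)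
  simp only [g, monomialFun_mk] at h2
  simp at h2
  exact h2.elim hi fun h => hi h.1

/-- The function `(g v)_i (g w)_j ^ (m - 1)` is an eigenfunction of right translation with
eigenvalue `c d ^ (m - 1)`. Taking `v = w` gives `c ^ m = 1`; varying `v` shows that `F` has only
one eigenvalue. -/
theorem eigenvalue_mul_of_isUnipotentElt (hm : 0 < m) {F : SL(n, ℂ)}
    (hF : IsUnipotentElt (regularFunctions n m) (QuotientGroup.mk F)) {c d : ℂ} {v w : Fin n → ℂ}
    (hv : (F : Matrix (Fin n) (Fin n) ℂ).mulVec v = c • v)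
    (hw : (F : Matrix (Fin n) (Fin n) ℂ).mulVec w = d • w) (hv0 : v ≠ 0) (hw0 : w ≠ 0) :
    c * d ^ (m - 1) = 1 := by
  obtain ⟨i, hi⟩ := Function.ne_iff.1 hv0
  obtain ⟨j, hj⟩ := Function.ne_iff.1 hw0
  have h1m : m ∣ 1 + (m - 1) := by rw [Nat.add_sub_cancel' hm]
  let f : Grp n m → ℂ := monomialFun v w i j h1m
  have hRf : (rightTranslation (QuotientGroup.mk F : Grp n m) - 1) f =
      (c * d ^ (m - 1) - 1) • f := by
    rw [LinearMap.sub_apply, rightTranslation_monomialFun, hv, hw]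
    ext z
    induction z using QuotientGroup.induction_on with
    | H z =>
      simp only [f, Pi.smul_apply, Pi.sub_apply, monomialFun_mk, Module.End.one_apply,
        Matrix.mulVec_smul, smul_eq_mul, mul_pow]
      ring
  obtain ⟨k, hk⟩ := hF f (monomialFun_mem v w i j h1m)
  have hpow : ∀ k : ℕ, ((rightTranslation (QuotientGroup.mk F : Grp n m) - 1) ^ k) f =
      (c * d ^ (m - 1) - 1) ^ k • f := by
    intro k
    induction k with
    | zero => simp
    | succ k ih =>
      rw [pow_succ', Module.End.mul_apply, ih, map_smul, hRf, smul_smul, ← pow_succ]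
  rw [hpow] at hk
  have h2 := congrFun hk (QuotientGroup.mk 1)
  have h3 : f (QuotientGroup.mk 1) ≠ 0 := by
    simp only [f, monomialFun_mk]
    simp at hi hj
    simp [hi, hj]
  have h4 := (mul_eq_zero.1 h2).resolve_right h3
  have hk0 : k ≠ 0 := by
    rintro rfl
    simp at h4
  exact sub_eq_zero.1 ((pow_eq_zero_iff hk0).1 h4)

/-- On matrix entries `R_U - 1` acts as right multiplication by `U - 1`, which is nilpotent. Sums
and products preserve local nilpotence, so all polynomials are covered. -/
theorem isUnipotentElt_mk {U : SL(n, ℂ)}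
    (hU : IsNilpotent ((U : Matrix (Fin n) (Fin n) ℂ) - 1)) :
    IsUnipotentElt (regularFunctions n m) (QuotientGroup.mk U) := by
  rintro f ⟨p, hp⟩
  have key : ∃ k : ℕ, ((rightTranslation U - 1) ^ k)
      (fun g : SL(n, ℂ) => MvPolynomial.eval (fun ij : Fin n × Fin n => g ij.1 ij.2) p) = 0 := by
    clear hp
    induction p using MvPolynomial.induction_on with
    | C a => exact ⟨1, by ext x; simp⟩
    | add p q hp hq =>
      obtain ⟨k, hk⟩ := hp
      obtain ⟨l, hl⟩ := hq
      refine ⟨k + l, ?_⟩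
      simp only [map_add]
      have h1 := map_add ((rightTranslation U - 1) ^ (k + l))
        (fun g : SL(n, ℂ) => MvPolynomial.eval (fun ij : Fin n × Fin n => g ij.1 ij.2) p)
        (fun g : SL(n, ℂ) => MvPolynomial.eval (fun ij : Fin n × Fin n => g ij.1 ij.2) q)
      refine h1.trans ?_
      rw [pow_add, Module.End.mul_apply, Module.End.mul_apply, hl, map_zero, add_zero,
        ← Module.End.mul_apply, ← pow_add, add_comm, pow_add, Module.End.mul_apply, hk, map_zero]
    | mul_X p ij hp =>
      obtain ⟨k, hk⟩ := hp
      obtain ⟨l, hl⟩ := hU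
      refine ⟨k + l, ?_⟩
      simp only [map_mul, MvPolynomial.eval_X]
      refine isLocallyNilpotent_mul U (k + l) k l _
        (fun g : SL(n, ℂ) => (g : Matrix (Fin n) (Fin n) ℂ) ij.1 ij.2) rfl hk ?_
      have h2 : ∀ l : ℕ, ((rightTranslation U - 1) ^ l)
          (fun g : SL(n, ℂ) => (g : Matrix (Fin n) (Fin n) ℂ) ij.1 ij.2) =
          fun g : SL(n, ℂ) => ((g : Matrix (Fin n) (Fin n) ℂ) *
            ((U : Matrix (Fin n) (Fin n) ℂ) - 1) ^ l) ij.1 ij.2 := by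
        intro l
        induction l with
        | zero => simp
        | succ l ih =>
          rw [pow_succ', Module.End.mul_apply, ih]
          ext g
          simp [pow_succ', ← mul_assoc, mul_sub, sub_mul]
      rw [h2, hl]
      ext g; simp
  obtain ⟨k, hk⟩ := key
  refine ⟨k, ?_⟩
  have h3 : ∀ (k : ℕ) (f : Grp n m → ℂ) (g : SL(n, ℂ)),
      ((rightTranslation (QuotientGroup.mk U : Grp n m) - 1) ^ k) f (QuotientGroup.mk g) =
      ((rightTranslation U - 1) ^ k) (fun g : SL(n, ℂ) => f (QuotientGroup.mk g)) g := by
    intro k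
    induction k with
    | zero => simp
    | succ k ih =>
      intro f g
      rw [pow_succ, Module.End.mul_apply, ih]
      rfl
  ext z
  induction z using QuotientGroup.induction_on with
  | H z =>
    rw [h3]
    simp only [hp]
    rw [hk]; rfl

end SLMod

/-! ### A torus from a direct sum decomposition. -/

namespace SLMod

open AlgGrp Module

section BlockScalar

variable {V : Type*} [AddCommGroup V] [Module ℂ V] {W₁ W₂ : Submodule ℂ V}

/-- The endomorphism that is `x` on `W₁` and `y` on `W₂`. -/
def blockScalar (h : IsCompl W₁ W₂) (x y : ℂ) : End ℂ V :=
  LinearMap.ofIsCompl h (x • W₁.subtype) (y • W₂.subtype)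

theorem blockScalar_left (h : IsCompl W₁ W₂) (x y : ℂ) {w : V} (hw : w ∈ W₁) :
    blockScalar h x y w = x • w := by
  rw [blockScalar]
  simpa using LinearMap.ofIsCompl_apply_left h (φ := x • W₁.subtype) (ψ := y • W₂.subtype) ⟨w, hw⟩

theorem blockScalar_right (h : IsCompl W₁ W₂) (x y : ℂ) {w : V} (hw : w ∈ W₂) :
    blockScalar h x y w = y • w := by
  rw [blockScalar]
  simpa using LinearMap.ofIsCompl_apply_right h (φ := x • W₁.subtype) (ψ := y • W₂.subtype) ⟨w, hw⟩

theorem eq_of_isCompl (h : IsCompl W₁ W₂) {f g : End ℂ V} (h1 : ∀ w ∈ W₁, f w = g w)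
    (h2 : ∀ w ∈ W₂, f w = g w) : f = g := by
  ext w
  obtain ⟨u, hu, v, hv, rfl⟩ := Submodule.mem_sup.1 (h.sup_eq_top ▸ Submodule.mem_top : w ∈ W₁ ⊔ W₂)
  rw [map_add, map_add, h1 u hu, h2 v hv]

theorem blockScalar_mul (h : IsCompl W₁ W₂) (x y x' y' : ℂ) :
    blockScalar h (x * x') (y * y') = blockScalar h x y * blockScalar h x' y' := by
  refine eq_of_isCompl h (fun w hw => ?_) fun w hw => ?_
  · rw [Module.End.mul_apply, blockScalar_left h _ _ hw, blockScalar_left h _ _ hw, map_smul,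
      blockScalar_left h _ _ hw, smul_smul, mul_comm]
  · rw [Module.End.mul_apply, blockScalar_right h _ _ hw, blockScalar_right h _ _ hw, map_smul,
      blockScalar_right h _ _ hw, smul_smul, mul_comm]

theorem blockScalar_self (h : IsCompl W₁ W₂) (x : ℂ) : blockScalar h x x = x • (1 : End ℂ V) :=
  eq_of_isCompl h (fun w hw => by simp [blockScalar_left h _ _ hw])
    fun w hw => by simp [blockScalar_right h _ _ hw]

theorem blockScalar_eq (h : IsCompl W₁ W₂) (x y : ℂ) :
    blockScalar h x y = x • blockScalar h 1 0 + y • blockScalar h 0 1 :=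
  eq_of_isCompl h (fun w hw => by simp [blockScalar_left h _ _ hw])
    fun w hw => by simp [blockScalar_right h _ _ hw]

theorem det_blockScalar [FiniteDimensional ℂ V] (h : IsCompl W₁ W₂) (x y : ℂ) :
    LinearMap.det (blockScalar h x y) = x ^ finrank ℂ W₁ * y ^ finrank ℂ W₂ := by
  have h1 : blockScalar h x y = (Submodule.prodEquivOfIsCompl W₁ W₂ h).toLinearMap ∘ₗ
      (LinearMap.prodMap (x • LinearMap.id) (y • LinearMap.id)) ∘ₗ
      (Submodule.prodEquivOfIsCompl W₁ W₂ h).symm.toLinearMap := by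
    rw [← LinearMap.comp_assoc, LinearEquiv.eq_comp_toLinearMap_symm]
    ext w
    · simp [blockScalar_left h x y w.2]
    · simp [blockScalar_right h x y w.2]
  rw [h1, LinearMap.det_conj, LinearMap.det_prodMap, LinearMap.det_smul, LinearMap.det_smul]
  simp

end BlockScalar

/-- The span of the characters `v ↦ v ^ (e * k)` of `ℂˣ`, where `k ∈ ℤ`. -/
def characterSpan (e : ℕ) : Submodule ℂ (ℂˣ → ℂ) :=
  Submodule.span ℂ (Set.range fun (k : ℤ) (v : ℂˣ) => (((v ^ e : ℂˣ) : ℂ)) ^ k)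

theorem mul_mem_characterSpan {e : ℕ} {f g : ℂˣ → ℂ} (hf : f ∈ characterSpan e)
    (hg : g ∈ characterSpan e) : f * g ∈ characterSpan e := by
  have h1 := Submodule.mul_mem_mul hf hg
  simp only [characterSpan] at h1 ⊢
  rw [Submodule.span_mul_span] at h1
  refine Submodule.span_mono ?_ h1
  rintro _ ⟨_, ⟨k, rfl⟩, _, ⟨l, rfl⟩, rfl⟩
  exact ⟨k + l, funext fun v => zpow_add₀ (Units.ne_zero _) k l⟩

/-- Averaging over the `e`-th roots of unity fixes `F` and kills every character whose exponent is
not divisible by `e`. -/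
theorem mem_characterSpan_of_invariant {e : ℕ} (he : 0 < e) {ξ : ℂˣ} (hξ : IsPrimitiveRoot ξ e)
    {F : ℂˣ → ℂ} (hF : F ∈ characterSpan 1) (hinv : ∀ v, F (ξ * v) = F v) :
    F ∈ characterSpan e := by
  let M : End ℂ (ℂˣ → ℂ) :=
    (e : ℂ)⁻¹ • ∑ i ∈ Finset.range e, LinearMap.funLeft ℂ ℂ (fun v => ξ ^ i * v)
  have hM : ∀ (F : ℂˣ → ℂ) (v : ℂˣ), M F v = (e : ℂ)⁻¹ * ∑ i ∈ Finset.range e, F (ξ ^ i * v) := by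
    intro F v
    simp [M, LinearMap.funLeft_apply]
  have he0 : (e : ℂ) ≠ 0 := by exact_mod_cast he.ne'
  have hMF : M F = F := by
    ext v
    have hi : ∀ i : ℕ, F (ξ ^ i * v) = F v := by
      intro i
      induction i with
      | zero => simp
      | succ i ih => rw [pow_succ', mul_assoc, hinv, ih]
    rw [hM]
    simp [hi, he0]
  rw [← hMF]
  have key : characterSpan 1 ≤ (characterSpan e).comap M := by
    refine Submodule.span_le.2 ?_
    rintro _ ⟨k, rfl⟩
    change M _ ∈ characterSpan e
    have h1 : M (fun v => (((v ^ 1 : ℂˣ) : ℂ)) ^ k) = ((e : ℂ)⁻¹ *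
        ∑ i ∈ Finset.range e, (((ξ ^ k : ℂˣ) : ℂ)) ^ i) • fun v : ℂˣ => (v : ℂ) ^ k := by
      ext v
      rw [hM]
      simp only [Pi.smul_apply, smul_eq_mul, mul_assoc, Finset.sum_mul]
      congr 1
      refine Finset.sum_congr rfl fun i _ => ?_
      push_cast
      rw [pow_one, mul_zpow, ← zpow_natCast, ← zpow_natCast, ← zpow_mul, ← zpow_mul, mul_comm k]
    rw [h1]
    by_cases hk : (e : ℤ) ∣ k
    · refine Submodule.smul_mem _ _ (Submodule.subset_span ?_)
      obtain ⟨l, rfl⟩ := hk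
      exact ⟨l, funext fun v => by push_cast; rw [zpow_mul, zpow_natCast]⟩
    · have h2 : (((ξ ^ k : ℂˣ) : ℂ)) ≠ 1 := by
        intro h
        exact hk ((hξ.zpow_eq_one_iff_dvd k).1 (Units.ext h))
      have h3 := mul_neg_geom_sum (((ξ ^ k : ℂˣ) : ℂ)) e
      have h4 : (ξ ^ k) ^ e = 1 := by
        rw [← zpow_natCast, ← zpow_mul, mul_comm, zpow_mul, zpow_natCast, hξ.pow_eq_one, one_zpow]
      rw [← Units.val_pow_eq_pow_val, h4, Units.val_one, sub_self] at h3
      rw [(mul_eq_zero.1 h3).resolve_left (sub_ne_zero.2 h2.symm)]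
      simp
  exact key hF

/-- On the one-parameter group acting by `v ^ b` on `W₁` and `v ^ (-a)` on `W₂`, a monomial of
bidegree `(p, q)` has weight `b p - a q`. The lemma realizes every multiple of the gcd by a monomial
that descends modulo `μ_m`. -/
theorem exists_exponents {a b m : ℕ} (ha : 0 < a) (hb : 0 < b) (hm : 0 < m) (ε : ℤ) :
    ∃ p q : ℕ, m ∣ p + q ∧ (b : ℤ) * p - a * q = ε * Nat.gcd (a + b) (b * m) := by
  have hbez := Nat.gcd_eq_gcd_ab (a + b) (b * m)
  set X := Nat.gcdA (a + b) (b * m)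
  set Y := Nat.gcdB (a + b) (b * m)
  -- Adding `(m K a, b m K)` to a Bézout solution makes both exponents nonnegative without changing
  -- the weight or divisibility by `m`.
  let K : ℤ := |ε * X| + |ε * (m * Y + X)|
  have hK : 0 ≤ K := by positivity
  have ha' : (1 : ℤ) ≤ a := by exact_mod_cast ha
  have hm' : (1 : ℤ) ≤ m := by exact_mod_cast hm
  have hb' : (1 : ℤ) ≤ b := by exact_mod_cast hb
  have h1 : 0 ≤ ε * (m * Y + X) + m * K * a := by
    have : K ≤ m * K * a := by
      have h2 : 1 * K ≤ m * K := mul_le_mul_of_nonneg_right hm' hK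
      have h3 : m * K * 1 ≤ m * K * a := mul_le_mul_of_nonneg_left ha' (by positivity)
      linarith
    have h4 := neg_abs_le (ε * (m * Y + X))
    have h5 := abs_nonneg (ε * X)
    simp only [K] at this ⊢
    linarith
  have h2 : 0 ≤ -(ε * X) + b * m * K := by
    have : K ≤ b * m * K := by
      have h2 : 1 * K ≤ (b * m) * K := mul_le_mul_of_nonneg_right (by nlinarith) hK
      linarith
    have h4 := le_abs_self (ε * X)
    have h5 := abs_nonneg (ε * (m * Y + X))
    simp only [K] at this ⊢
    linarith
  obtain ⟨p, hp⟩ := Int.eq_ofNat_of_zero_le h1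
  obtain ⟨q, hq⟩ := Int.eq_ofNat_of_zero_le h2
  refine ⟨p, q, ?_, ?_⟩
  · have : (m : ℤ) ∣ ((p + q : ℕ) : ℤ) := by
      push_cast
      rw [← hp, ← hq]
      exact ⟨ε * Y + K * a + b * K, by ring⟩
    exact_mod_cast this
  · rw [← hp, ← hq, hbez]
    push_cast
    ring

/-- The map `θ`, acting by `v ^ b` on `W₁` and `v ^ (-a)` on `W₂`, has determinant one but need not
be injective modulo `μ_m`. It is factored through `v ↦ v ^ e`, and the resulting `ψ` is a closed
immersion: regular functions pull back to Laurent polynomials, and all characters occur. -/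
theorem containsNontrivialTorus_of_isCompl {n m : ℕ} (hn : 0 < n) (hm : 0 < m)
    {W₁ W₂ : Submodule ℂ (Fin n → ℂ)} (h : IsCompl W₁ W₂) (h1 : W₁ ≠ ⊥) (h2 : W₂ ≠ ⊥)
    {H : Subgroup (Grp n m)}
    (hH : ∀ (g : SL(n, ℂ)) (x y : ℂ), Matrix.toLin' (g : Matrix (Fin n) (Fin n) ℂ) =
      blockScalar h x y → (QuotientGroup.mk g : Grp n m) ∈ H) :
    ContainsNontrivialTorus (regularFunctions n m) H := by
  set a := finrank ℂ W₁ with ha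
  set b := finrank ℂ W₂ with hb
  have ha0 : 0 < a := Submodule.one_le_finrank_iff.2 h1
  have hb0 : 0 < b := Submodule.one_le_finrank_iff.2 h2
  have hab : a + b = n := by simpa using Submodule.finrank_add_eq_of_isCompl h
  -- An element `θ v` lies in `μ_m` when `v ^ b = v ^ (-a)` and `v ^ (b m) = 1`; both hold if `v ^ e
  -- = 1`.
  set e := Nat.gcd (a + b) (b * m) with he
  have he0 : 0 < e := Nat.gcd_pos_of_pos_left _ (by omega)
  let D : ℂˣ → End ℂ (Fin n → ℂ) := fun v =>
    blockScalar h ((v ^ b : ℂˣ) : ℂ) (((v ^ a)⁻¹ : ℂˣ) : ℂ)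
  let θ : ℂˣ →* SL(n, ℂ) :=
    { toFun := fun v => ⟨LinearMap.toMatrix' (D v), by
        rw [LinearMap.det_toMatrix', det_blockScalar, ← ha, ← hb, ← Units.val_pow_eq_pow_val,
          ← Units.val_pow_eq_pow_val, ← Units.val_mul, inv_pow, ← pow_mul, ← pow_mul, mul_comm b,
          mul_inv_cancel, Units.val_one]⟩
      map_one' := by
        refine Subtype.ext ?_
        change LinearMap.toMatrix' (D 1) = 1
        have : D 1 = LinearMap.id := by simp [D, blockScalar_self]; rfl
        rw [this, LinearMap.toMatrix'_id]
      map_mul' := fun v w => by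
        refine Subtype.ext ?_
        change LinearMap.toMatrix' (D (v * w)) =
          LinearMap.toMatrix' (D v) * LinearMap.toMatrix' (D w)
        rw [← LinearMap.toMatrix'_mul, ← blockScalar_mul, ← Units.val_mul, ← Units.val_mul,
          ← mul_pow, ← mul_inv, ← mul_pow] }
  have hθ : ∀ v, ((θ v : SL(n, ℂ)) : Matrix (Fin n) (Fin n) ℂ) = LinearMap.toMatrix' (D v) :=
    fun v => rfl
  have hθ' : ∀ v w, (θ v : Matrix (Fin n) (Fin n) ℂ).mulVec w = D v w := fun v w => by
    rw [hθ, ← Matrix.toLin'_apply, Matrix.toLin'_toMatrix']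
  let φ₀ : ℂˣ →* Grp n m := (QuotientGroup.mk' (mu n m)).comp θ
  have hsurj : Function.Surjective (powMonoidHom e : ℂˣ →* ℂˣ) := by
    intro w
    obtain ⟨z, hz⟩ := IsAlgClosed.exists_pow_nat_eq (w : ℂ) he0
    have hz0 : z ≠ 0 := by
      rintro rfl
      rw [zero_pow he0.ne'] at hz
      exact w.ne_zero hz.symm
    exact ⟨Units.mk0 z hz0, Units.ext hz⟩
  have hker : (powMonoidHom e : ℂˣ →* ℂˣ).ker ≤ φ₀.ker := by
    intro v hv
    rw [MonoidHom.mem_ker, powMonoidHom_apply] at hv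
    have hvn : v ^ (a + b) = 1 := by
      obtain ⟨c, hc⟩ := Nat.gcd_dvd_left (a + b) (b * m)
      rw [hc, pow_mul, hv, one_pow]
    have hvb : v ^ (b * m) = 1 := by
      obtain ⟨c, hc⟩ := Nat.gcd_dvd_right (a + b) (b * m)
      rw [hc, pow_mul, hv, one_pow]
    have hva : (v ^ a)⁻¹ = v ^ b := by
      rw [inv_eq_iff_mul_eq_one, ← pow_add, hvn]
    rw [MonoidHom.mem_ker]
    refine (QuotientGroup.eq_one_iff _).2 ⟨((v ^ b : ℂˣ) : ℂ), ?_, ?_⟩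
    · rw [← Units.val_pow_eq_pow_val, ← pow_mul, hvb, Units.val_one]
    · rw [hθ]
      simp only [D]
      rw [hva, blockScalar_self, map_smul]
      change _ • LinearMap.toMatrix' LinearMap.id = _
      rw [LinearMap.toMatrix'_id, Matrix.scalar_apply, Matrix.smul_one_eq_diagonal]
  let ψ : ℂˣ →* Grp n m := (powMonoidHom e : ℂˣ →* ℂˣ).liftOfSurjective hsurj ⟨φ₀, hker⟩
  have hψ : ∀ v, ψ (v ^ e) = φ₀ v := fun v =>
    MonoidHom.liftOfRightInverse_comp_apply (powMonoidHom e : ℂˣ →* ℂˣ) _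
      (Function.rightInverse_surjInv hsurj) ⟨φ₀, hker⟩ v
  let φ : (Fin 1 → ℂˣ) →* Grp n m := ψ.comp (Pi.evalMonoidHom (fun _ => ℂˣ) 0)
  have hφ : ∀ w, φ w = ψ (w 0) := fun w => rfl
  have hsub : (Subalgebra.toSubmodule (regularFunctions n m)).map (LinearMap.funLeft ℂ ℂ φ) ≤
      laurentFunctions 1 := by
    rintro _ ⟨f, hf, rfl⟩
    have hF : (fun v => f (φ₀ v)) ∈ characterSpan e := by
      obtain ⟨ξ, hξ⟩ : ∃ ξ : ℂˣ, IsPrimitiveRoot ξ e := by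
        refine ⟨_, (Complex.isPrimitiveRoot_exp e he0.ne').isUnit_unit he0.ne'⟩
      refine mem_characterSpan_of_invariant he0 hξ ?_ fun v => ?_
      · obtain ⟨p, hp⟩ := hf
        have hp' : (fun v => f (φ₀ v)) = fun v =>
            MvPolynomial.eval (fun ij : Fin n × Fin n => (θ v) ij.1 ij.2) p := funext fun v => hp _
        rw [hp']
        have hchar : ∀ k : ℤ, (fun v : ℂˣ => (v : ℂ) ^ k) ∈ characterSpan 1 := fun k =>
          Submodule.subset_span ⟨k, by simp⟩
        clear hp hp'
        induction p using MvPolynomial.induction_on with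
        | C c =>
          have := Submodule.smul_mem _ c (hchar 0)
          convert this using 1
          ext v; simp
        | add p q hp hq =>
          simp only [map_add]
          exact Submodule.add_mem _ hp hq
        | mul_X p ij hp =>
          simp only [map_mul, MvPolynomial.eval_X]
          refine mul_mem_characterSpan hp ?_
          have h3 : (fun v : ℂˣ => ((θ v : SL(n, ℂ)) : Matrix (Fin n) (Fin n) ℂ) ij.1 ij.2) =
              (LinearMap.toMatrix' (blockScalar h 1 0) ij.1 ij.2) •
                (fun v : ℂˣ => (v : ℂ) ^ (b : ℤ)) +
              (LinearMap.toMatrix' (blockScalar h 0 1) ij.1 ij.2) •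
                (fun v : ℂˣ => (v : ℂ) ^ (-(a : ℤ))) := by
            ext v
            rw [hθ]
            simp only [D]
            rw [blockScalar_eq]
            simp [mul_comm]
          exact h3 ▸ Submodule.add_mem _ (Submodule.smul_mem _ _ (hchar _))
            (Submodule.smul_mem _ _ (hchar _))
      · have hξ1 : φ₀ ξ = 1 := hker (by
          rw [MonoidHom.mem_ker, powMonoidHom_apply, hξ.pow_eq_one])
        rw [map_mul, hξ1, one_mul]
    have hmap : characterSpan e ≤ (laurentFunctions 1).map
        (LinearMap.funLeft ℂ ℂ fun (v : ℂˣ) (_ : Fin 1) => v ^ e) := by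
      refine Submodule.span_le.2 ?_
      rintro _ ⟨k, rfl⟩
      exact ⟨_, Submodule.subset_span ⟨fun _ => k, rfl⟩, by
        ext v; simp [LinearMap.funLeft_apply]⟩
    obtain ⟨G, hG, hGF⟩ := hmap hF
    have hGf : LinearMap.funLeft ℂ ℂ φ f = G := by
      ext w
      obtain ⟨v, hv⟩ := hsurj (w 0)
      have hw : w = fun _ => v ^ e := funext fun i => by rw [Subsingleton.elim i 0]; exact hv.symm
      have := congrFun hGF v
      rw [LinearMap.funLeft_apply] at this ⊢
      rw [hφ, hw, hψ, this]
    rw [hGf]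
    exact hG
  have hchar : ∀ ε : ℤ, (fun w : Fin 1 → ℂˣ => (w 0 : ℂ) ^ ε) ∈
      (Subalgebra.toSubmodule (regularFunctions n m)).map (LinearMap.funLeft ℂ ℂ φ) := by
    intro ε
    obtain ⟨x, hx, hx0⟩ := Submodule.exists_mem_ne_zero_of_ne_bot h1
    obtain ⟨y, hy, hy0⟩ := Submodule.exists_mem_ne_zero_of_ne_bot h2
    obtain ⟨i, hi⟩ := Function.ne_iff.1 hx0
    obtain ⟨j, hj⟩ := Function.ne_iff.1 hy0
    obtain ⟨p, q, hpq, hpq'⟩ := exists_exponents (b := b) ha0 hb0 hm ε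
    have hc : x i ^ p * y j ^ q ≠ 0 := mul_ne_zero (pow_ne_zero _ hi) (pow_ne_zero _ hj)
    refine ⟨(x i ^ p * y j ^ q)⁻¹ • monomialFun x y i j hpq,
      Submodule.smul_mem _ _ (monomialFun_mem x y i j hpq), ?_⟩
    ext w
    obtain ⟨v, hv⟩ := hsurj (w 0)
    rw [powMonoidHom_apply] at hv
    rw [LinearMap.funLeft_apply, hφ, ← hv, hψ]
    have h3 : monomialFun x y i j hpq (φ₀ v) = (v : ℂ) ^ (ε * e) * (x i ^ p * y j ^ q) := by
      change monomialFun x y i j hpq (QuotientGroup.mk (θ v)) = _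
      rw [monomialFun_mk, hθ', hθ']
      simp only [D]
      rw [blockScalar_left h _ _ hx, blockScalar_right h _ _ hy, ← hpq',
        zpow_sub₀ (Units.ne_zero v), zpow_mul, zpow_mul]
      simp only [Pi.smul_apply, smul_eq_mul, mul_pow]
      push_cast
      simp only [zpow_natCast, inv_pow]
      field_simp
    rw [Pi.smul_apply, h3, smul_eq_mul, mul_comm, mul_assoc, mul_inv_cancel₀ hc, mul_one]
    push_cast
    rw [mul_comm ε, zpow_mul, zpow_natCast]
  refine ⟨φ.range, ⟨1, φ, le_antisymm hsub (Submodule.span_le.2 ?_), rfl⟩, ?_, ?_⟩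
  · rintro _ ⟨k, rfl⟩
    simpa using hchar (k 0)
  -- The coordinate character is a pullback along `φ`, so `φ` trivial would force `1 = 2`.
  · intro hbot
    obtain ⟨f, -, hf⟩ := hchar 1
    have hφ1 : ∀ w, φ w = 1 := fun w => by
      have : φ w ∈ φ.range := ⟨w, rfl⟩
      rwa [hbot, Subgroup.mem_bot] at this
    have h3 := congrFun hf 1
    have h4 := congrFun hf (fun _ => Units.mk0 2 two_ne_zero)
    rw [LinearMap.funLeft_apply, hφ1] at h3 h4
    rw [h3] at h4
    norm_num at h4
  · rintro _ ⟨w, rfl⟩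
    obtain ⟨v, hv⟩ := hsurj (w 0)
    rw [powMonoidHom_apply] at hv
    rw [hφ, ← hv, hψ]
    exact hH (θ v) _ _ ((congrArg Matrix.toLin' (hθ v)).trans (Matrix.toLin'_toMatrix' (D v)))

end SLMod

/-! ### Operators commuting with an indecomposable representation. -/

namespace CommutingPair

open Module

variable {V : Type*} [AddCommGroup V] [Module ℂ V]

/-- The hypothesis `hf` excludes Jordan chains of length two, so for an eigenvalue `a` the kernel
and range of `f - a` are complementary. Both are stable and the kernel is nonzero, so the range is
zero. -/
theorem eq_smul_one_of_isIndecomposable [FiniteDimensional ℂ V] [Nontrivial V] {S T N f : End ℂ V}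
    (hind : IsIndecomposable S T N) (hs : Commute f S) (ht : Commute f T) (hn : Commute f N)
    (hf : ∀ (c : ℂ) (v w : V), f v = c • v + w → f w = c • w → w = 0) :
    ∃ a : ℂ, f = a • (1 : End ℂ V) := by
  obtain ⟨a, ha⟩ := Module.End.exists_eigenvalue f
  obtain ⟨v₀, hv₀⟩ := ha.exists_hasEigenvector
  refine ⟨a, ?_⟩
  let h : End ℂ V := f - a • (1 : End ℂ V)
  have happ : ∀ x, h x = f x - a • x := fun x => rfl
  have hcomm : ∀ R : End ℂ V, Commute f R → Commute h R := fun R hR =>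
    hR.sub_left ((Commute.one_left R).smul_left a)
  have hdisj : Disjoint (LinearMap.ker h) (LinearMap.range h) := by
    rw [Submodule.disjoint_def]
    rintro _ hx ⟨v, rfl⟩
    rw [LinearMap.mem_ker, happ (h v), sub_eq_zero] at hx
    exact hf a v (h v) (by rw [happ]; abel) hx
  have hcompl : IsCompl (LinearMap.ker h) (LinearMap.range h) := by
    refine ⟨hdisj, codisjoint_iff.2 (Submodule.eq_top_of_disjoint _ _ ?_ hdisj)⟩
    rw [add_comm, LinearMap.finrank_range_add_finrank_ker]
  have hker : ∀ R : End ℂ V, Commute f R → ∀ x ∈ LinearMap.ker h, R x ∈ LinearMap.ker h := by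
    intro R hR x hx
    rw [LinearMap.mem_ker] at hx ⊢
    rw [← Module.End.mul_apply, (hcomm R hR).eq, Module.End.mul_apply, hx, map_zero]
  have hrange : ∀ R : End ℂ V, Commute f R → ∀ x ∈ LinearMap.range h, R x ∈ LinearMap.range h := by
    rintro R hR _ ⟨x, rfl⟩
    exact ⟨R x, by rw [← Module.End.mul_apply, (hcomm R hR).eq, Module.End.mul_apply]⟩
  have hr := (hind _ _ hcompl (fun x hx => ⟨hker S hs x hx, hker T ht x hx, hker N hn x hx⟩)
    (fun x hx => ⟨hrange S hs x hx, hrange T ht x hx, hrange N hn x hx⟩)).resolve_left (by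
      intro hbot
      have : v₀ ∈ LinearMap.ker h := by
        rw [LinearMap.mem_ker, happ, hv₀.apply_eq_smul, sub_self]
      rw [hbot, Submodule.mem_bot] at this
      exact hv₀.2 this)
  exact sub_eq_zero.1 (LinearMap.range_eq_bot.1 hr)

theorem isNilpotent_sub_of_eigenvalue_unique [FiniteDimensional ℂ V] {f : End ℂ V} {a : ℂ}
    (h : ∀ c, f.HasEigenvalue c → c = a) : IsNilpotent (f - a • (1 : End ℂ V)) := by
  have htop : f.maxGenEigenspace a = ⊤ := by
    rw [← Module.End.iSup_maxGenEigenspace_eq_top f]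
    refine le_antisymm (le_iSup f.maxGenEigenspace a) (iSup_le fun c => ?_)
    by_cases hc : f.maxGenEigenspace c = ⊥
    · rw [hc]; exact bot_le
    · have h1 : f.HasUnifEigenvalue c ⊤ := hc
      rw [h c (h1.lt one_pos)]
  rw [Module.End.maxGenEigenspace_eq_genEigenspace_finrank] at htop
  refine ⟨finrank ℂ V, ?_⟩
  ext x
  have : x ∈ f.genEigenspace a (finrank ℂ V : ℕ) := htop ▸ Submodule.mem_top
  rw [Module.End.mem_genEigenspace_nat] at this
  exact this

end CommutingPair

/-! ### From triples to models. -/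

namespace SLMod

open AlgGrp Module CommutingPair

variable {n m : ℕ}

/-- The endomorphism of `ℂ ^ n` given by an element of `SL_n(ℂ)`. -/
def toEnd (g : SL(n, ℂ)) : End ℂ (Fin n → ℂ) :=
  Matrix.toLinAlgEquiv' (g : Matrix (Fin n) (Fin n) ℂ)

theorem toEnd_mul (g h : SL(n, ℂ)) : toEnd (g * h) = toEnd g * toEnd h := by
  rw [toEnd, Matrix.SpecialLinearGroup.coe_mul, map_mul]; rfl

theorem toEnd_one : toEnd (1 : SL(n, ℂ)) = 1 := by
  rw [toEnd, Matrix.SpecialLinearGroup.coe_one, map_one]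

theorem toEnd_pow (g : SL(n, ℂ)) (k : ℕ) : toEnd (g ^ k) = toEnd g ^ k := by
  rw [toEnd, Matrix.SpecialLinearGroup.coe_pow, map_pow]; rfl

theorem toEnd_injective : Function.Injective (toEnd : SL(n, ℂ) → End ℂ (Fin n → ℂ)) :=
  fun _ _ h => Subtype.ext (Matrix.toLinAlgEquiv'.injective h)

theorem det_toEnd (g : SL(n, ℂ)) : LinearMap.det (toEnd g) = 1 :=
  (LinearMap.det_toLin' _).trans g.2

theorem toEnd_inv_mul (g : SL(n, ℂ)) : toEnd g⁻¹ * toEnd g = 1 := by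
  rw [← toEnd_mul, inv_mul_cancel, toEnd_one]

theorem toEnd_mul_inv (g : SL(n, ℂ)) : toEnd g * toEnd g⁻¹ = 1 := by
  rw [← toEnd_mul, mul_inv_cancel, toEnd_one]

theorem toEnd_eq_smul_one_iff (g : SL(n, ℂ)) (c : ℂ) : toEnd g = c • (1 : End ℂ (Fin n → ℂ)) ↔
    (g : Matrix (Fin n) (Fin n) ℂ) = Matrix.scalar (Fin n) c := by
  rw [toEnd, ← Algebra.algebraMap_eq_smul_one, ← Matrix.toLinAlgEquiv'.commutes c,
    Matrix.toLinAlgEquiv'.injective.eq_iff]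
  rfl

theorem mem_mu_iff (g : SL(n, ℂ)) :
    g ∈ mu n m ↔ ∃ ζ : ℂ, ζ ^ m = 1 ∧ toEnd g = ζ • (1 : End ℂ (Fin n → ℂ)) := by
  simp only [toEnd_eq_smul_one_iff]; rfl

theorem exists_toEnd_eq {f : End ℂ (Fin n → ℂ)} (hf : LinearMap.det f = 1) :
    ∃ g : SL(n, ℂ), toEnd g = f :=
  ⟨⟨LinearMap.toMatrix' f, by rw [LinearMap.det_toMatrix', hf]⟩, Matrix.toLin'_toMatrix' f⟩

theorem exists_toEnd_eq_smul_one {ω : ℂ} (hω : ω ^ n = 1) :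
    ∃ g : SL(n, ℂ), toEnd g = ω • (1 : End ℂ (Fin n → ℂ)) :=
  exists_toEnd_eq (by rw [LinearMap.det_smul]; simp [hω])

theorem pow_eq_one_of_toEnd {g : SL(n, ℂ)} {c : ℂ} (h : toEnd g = c • (1 : End ℂ (Fin n → ℂ))) :
    c ^ n = 1 := by
  have := det_toEnd g
  rw [h, LinearMap.det_smul] at this
  simpa using this

theorem exists_toEnd_comm {g h : SL(n, ℂ)}
    (hc : Commute (QuotientGroup.mk g : Grp n m) (QuotientGroup.mk h)) :
    ∃ ξ : ℂ, ξ ^ m = 1 ∧ toEnd g * toEnd h = ξ • (toEnd h * toEnd g) := by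
  have h1 : (QuotientGroup.mk (g * h) : Grp n m) = QuotientGroup.mk (h * g) := hc
  have h2 := QuotientGroup.eq.1 h1.symm
  obtain ⟨ξ, hξ, hξ'⟩ := (mem_mu_iff _).1 h2
  refine ⟨ξ, hξ, ?_⟩
  rw [← toEnd_mul, ← toEnd_mul, ← mul_inv_cancel_left (h * g) (g * h), toEnd_mul (h * g), hξ']
  simp

theorem commute_mk {g h : SL(n, ℂ)} {ξ : ℂ} (hξ : ξ ^ m = 1)
    (hc : toEnd g * toEnd h = ξ • (toEnd h * toEnd g)) :
    Commute (QuotientGroup.mk g : Grp n m) (QuotientGroup.mk h) := by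
  have h1 : (QuotientGroup.mk (g * h) : Grp n m) = QuotientGroup.mk (h * g) := by
    refine (QuotientGroup.eq.2 ((mem_mu_iff _).2 ⟨ξ, hξ, ?_⟩)).symm
    rw [toEnd_mul, toEnd_mul, hc, mul_smul_comm, ← toEnd_mul, ← toEnd_mul, inv_mul_cancel,
      toEnd_one]
  exact h1

/-- If `g U g⁻¹ = ξ U`, taking traces gives `n = ξ n`, so `ξ = 1`. -/
theorem commute_toEnd_of_isNilpotent (hn : 0 < n) {g U : SL(n, ℂ)} (hU : IsNilpotent (toEnd U - 1))
    (hc : Commute (QuotientGroup.mk g : Grp n m) (QuotientGroup.mk U)) :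
    Commute (toEnd g) (toEnd U) := by
  obtain ⟨ξ, -, hξ⟩ := exists_toEnd_comm hc
  have htr : LinearMap.trace ℂ (Fin n → ℂ) (toEnd U) = n := by
    have h1 := (LinearMap.isNilpotent_trace_of_isNilpotent hU).eq_zero
    rw [map_sub, LinearMap.trace_one, sub_eq_zero] at h1
    simpa using h1
  have h2 : toEnd g * toEnd U * toEnd g⁻¹ = ξ • toEnd U := by
    rw [hξ, smul_mul_assoc, mul_assoc, toEnd_mul_inv, mul_one]
  have h3 := congrArg (LinearMap.trace ℂ (Fin n → ℂ)) h2
  rw [LinearMap.trace_mul_comm, ← mul_assoc, toEnd_inv_mul, one_mul, map_smul, htr,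
    smul_eq_mul] at h3
  have hn0 : (n : ℂ) ≠ 0 := by exact_mod_cast hn.ne'
  have h4 : ξ = 1 := mul_right_cancel₀ hn0 (by rw [← h3, one_mul])
  rw [h4, one_smul] at hξ
  exact hξ

/-- Any lift has a single eigenvalue `ω`, with `ω ^ m = 1`. Dividing by `ω` keeps the class and, as
`m ∣ n`, the determinant. -/
theorem exists_isNilpotent_lift (hn : 0 < n) (hm : 0 < m) (hmn : m ∣ n) {u : Grp n m}
    (hu : IsUnipotentElt (regularFunctions n m) u) :
    ∃ U : SL(n, ℂ), (QuotientGroup.mk U : Grp n m) = u ∧ IsNilpotent (toEnd U - 1) := by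
  induction u using QuotientGroup.induction_on with
  | H F =>
    have : Nonempty (Fin n) := ⟨⟨0, hn⟩⟩
    obtain ⟨ω, hω⟩ := Module.End.exists_eigenvalue (toEnd F)
    obtain ⟨v, hv⟩ := hω.exists_hasEigenvector
    have h1 := eigenvalue_mul_of_isUnipotentElt hm hu hv.apply_eq_smul hv.apply_eq_smul hv.2 hv.2
    have hω0 : ω ≠ 0 := by
      rintro rfl
      simp at h1
    have hωm : ω ^ m = 1 := by rw [← h1, ← pow_succ', Nat.sub_add_cancel hm]
    have huniq : ∀ c, (toEnd F).HasEigenvalue c → c = ω := by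
      intro c hc
      obtain ⟨w, hw⟩ := hc.exists_hasEigenvector
      have h2 := eigenvalue_mul_of_isUnipotentElt hm hu hw.apply_eq_smul hv.apply_eq_smul hw.2 hv.2
      exact mul_right_cancel₀ (pow_ne_zero (m - 1) hω0) (h2.trans h1.symm)
    obtain ⟨k, hk⟩ := hmn
    obtain ⟨Z, hZ⟩ := exists_toEnd_eq_smul_one (n := n) (ω := ω⁻¹) (by
      rw [hk, pow_mul, inv_pow, hωm, inv_one, one_pow])
    have hZm : Z ∈ mu n m := (mem_mu_iff Z).2 ⟨ω⁻¹, by rw [inv_pow, hωm, inv_one], hZ⟩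
    refine ⟨F * Z, (QuotientGroup.eq.2 (by simpa using hZm)).symm, ?_⟩
    have h3 : toEnd (F * Z) - 1 = ω⁻¹ • (toEnd F - ω • (1 : End ℂ (Fin n → ℂ))) := by
      rw [toEnd_mul, hZ, smul_sub, smul_smul, inv_mul_cancel₀ hω0]
      simp
    rw [h3]
    exact (isNilpotent_sub_of_eigenvalue_unique huniq).smul _

theorem toEnd_comm_of_liftCommutator {S T γ : SL(n, ℂ)} {ζ : ℂ}
    (hγ : toEnd γ = ζ • (1 : End ℂ (Fin n → ℂ)))
    (h : liftCommutator (QuotientGroup.mk S : Grp n m) (QuotientGroup.mk T) = γ) :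
    toEnd S * toEnd T = ζ • (toEnd T * toEnd S) := by
  have h1 : S * T * S⁻¹ * T⁻¹ = γ := h
  have h2 : S * T = γ * (T * S) := by rw [← h1]; group
  rw [← toEnd_mul, h2, toEnd_mul, hγ, toEnd_mul]
  simp

theorem liftCommutator_eq {S T γ : SL(n, ℂ)} {ζ : ℂ}
    (hγ : toEnd γ = ζ • (1 : End ℂ (Fin n → ℂ)))
    (h : toEnd S * toEnd T = ζ • (toEnd T * toEnd S)) :
    liftCommutator (QuotientGroup.mk S : Grp n m) (QuotientGroup.mk T) = γ := by
  have h2 : S * T = γ * (T * S) := toEnd_injective (by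
    rw [toEnd_mul, h, toEnd_mul, hγ, toEnd_mul]
    simp)
  change S * T * S⁻¹ * T⁻¹ = γ
  rw [h2]; group

theorem isIndecomposable_of_isN2Triple (hn : 0 < n) (hm : 0 < m) {S T U : SL(n, ℂ)}
    (h : ¬ ContainsNontrivialTorus (regularFunctions n m) (Subgroup.centralizer
      {(QuotientGroup.mk S : Grp n m), QuotientGroup.mk T, QuotientGroup.mk U})) :
    IsIndecomposable (toEnd S) (toEnd T) (toEnd U - 1) := by
  intro W₁ W₂ hW h₁ h₂
  by_contra! hcon
  refine h (containsNontrivialTorus_of_isCompl hn hm hW hcon.1 hcon.2 fun g x y hg => ?_)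
  have hg' : toEnd g = blockScalar hW x y := hg
  have key : ∀ R : SL(n, ℂ), (∀ w ∈ W₁, toEnd R w ∈ W₁) → (∀ w ∈ W₂, toEnd R w ∈ W₂) →
      (QuotientGroup.mk R : Grp n m) * QuotientGroup.mk g =
        QuotientGroup.mk g * QuotientGroup.mk R := by
    intro R hR₁ hR₂
    have : R * g = g * R := by
      refine toEnd_injective ?_
      rw [toEnd_mul, toEnd_mul, hg']
      refine eq_of_isCompl hW (fun w hw => ?_) fun w hw => ?_
      · rw [Module.End.mul_apply, Module.End.mul_apply, blockScalar_left hW _ _ hw,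
          blockScalar_left hW _ _ (hR₁ w hw), map_smul]
      · rw [Module.End.mul_apply, Module.End.mul_apply, blockScalar_right hW _ _ hw,
          blockScalar_right hW _ _ (hR₂ w hw), map_smul]
    rw [← QuotientGroup.mk_mul, this, QuotientGroup.mk_mul]
  have hU : ∀ W : Submodule ℂ (Fin n → ℂ), (∀ w ∈ W, (toEnd U - 1) w ∈ W) →
      ∀ w ∈ W, toEnd U w ∈ W := fun W hW w hw => by
    have := W.add_mem (hW w hw) hw
    simpa using this
  rw [Subgroup.mem_centralizer_iff]
  rintro _ (rfl | rfl | rfl)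
  · exact key S (fun w hw => (h₁ w hw).1) fun w hw => (h₂ w hw).1
  · exact key T (fun w hw => (h₁ w hw).2.1) fun w hw => (h₂ w hw).2.1
  · exact key U (hU _ fun w hw => (h₁ w hw).2.2) (hU _ fun w hw => (h₂ w hw).2.2)

/-- Applied with `F = S` and `F = T`: `d` is the order of `ζ`, so their `d`-th powers commute with
`S`, `T` and `N`. -/
theorem pow_toEnd_eq_smul_one (hn : 0 < n) (hm : 0 < m) {F : SL(n, ℂ)} {d : ℕ}
    (hF : IsSemisimpleElt (regularFunctions n m) (QuotientGroup.mk F))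
    {S T N : End ℂ (Fin n → ℂ)} (hind : IsIndecomposable S T N) (hs : Commute (toEnd F ^ d) S)
    (ht : Commute (toEnd F ^ d) T) (hN : Commute (toEnd F ^ d) N) :
    ∃ a : ℂ, a ≠ 0 ∧ toEnd F ^ d = a • (1 : End ℂ (Fin n → ℂ)) := by
  have : Nonempty (Fin n) := ⟨⟨0, hn⟩⟩
  have hFd := hF.pow d
  rw [← QuotientGroup.mk_pow] at hFd
  obtain ⟨a, ha⟩ := eq_smul_one_of_isIndecomposable hind hs ht hN fun c v w hv hw => by
    rw [← toEnd_pow] at hv hw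
    exact mulVec_eq_smul_of_isSemisimpleElt hm hFd hv hw
  refine ⟨a, ?_, ha⟩
  rintro rfl
  rw [← toEnd_pow] at ha
  have := pow_eq_one_of_toEnd ha
  rw [zero_pow hn.ne'] at this
  exact zero_ne_one this

theorem exists_isModel_lift (hn : 0 < n) (hm : 0 < m) (hmn : m ∣ n) {s t u : Grp n m}
    {γ : SL(n, ℂ)} {ζ : ℂ} {d : ℕ} (hd : 0 < d) (hζ : IsPrimitiveRoot ζ d)
    (hγ : toEnd γ = ζ • (1 : End ℂ (Fin n → ℂ))) (h : IsN2Triple (regularFunctions n m) s t u)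
    (hst : liftCommutator s t = γ) :
    ∃ (S T U : SL(n, ℂ)) (α b : ℂ) (k : ℕ), (QuotientGroup.mk S : Grp n m) = s ∧
      (QuotientGroup.mk T : Grp n m) = t ∧ (QuotientGroup.mk U : Grp n m) = u ∧ α ≠ 0 ∧ b ≠ 0 ∧
      d * k = n ∧ IsModel (toEnd S) (toEnd T) (toEnd U - 1) ζ α b d k := by
  have : Nonempty (Fin n) := ⟨⟨0, hn⟩⟩
  obtain ⟨U, rfl, hU⟩ := exists_isNilpotent_lift hn hm hmn h.unipotent_u
  induction s using QuotientGroup.induction_on with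
  | H S =>
  induction t using QuotientGroup.induction_on with
  | H T =>
  have hSU := (commute_toEnd_of_isNilpotent hn hU h.comm_su).sub_right (Commute.one_right _)
  have hTU := (commute_toEnd_of_isNilpotent hn hU h.comm_tu).sub_right (Commute.one_right _)
  have hST := toEnd_comm_of_liftCommutator hγ hst
  have hζ0 : ζ ≠ 0 := hζ.ne_zero hd.ne'
  have hTS : toEnd T * toEnd S = ζ⁻¹ • (toEnd S * toEnd T) := by
    rw [hST, smul_smul, inv_mul_cancel₀ hζ0, one_smul]
  have hind := isIndecomposable_of_isN2Triple hn hm h.no_torus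
  obtain ⟨a, ha0, ha⟩ := pow_toEnd_eq_smul_one (d := d) hn hm h.semisimple_s hind
    ((Commute.refl _).pow_left d)
    (by
      have := comm_pow hTS d
      rw [inv_pow, hζ.pow_eq_one, inv_one, one_smul] at this
      exact this.symm)
    (hSU.pow_left d)
  obtain ⟨b, hb0, hb⟩ := pow_toEnd_eq_smul_one (d := d) hn hm h.semisimple_t hind
    (by
      have := comm_pow hST d
      rw [hζ.pow_eq_one, one_smul] at this
      exact this.symm)
    ((Commute.refl _).pow_left d) (hTU.pow_left d)
  obtain ⟨α, k, hα, hmod⟩ := exists_isModel_of_isIndecomposable hd hζ hST hSU hTU hU ha0 hb0 ha hb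
    hind
  refine ⟨S, T, U, α, b, k, rfl, rfl, rfl, hα, hb0, ?_, hmod⟩
  obtain ⟨v, -, -, e, -⟩ := hmod.exists_basis
  have := Module.finrank_eq_card_basis e
  simpa using this.symm

end SLMod

/-! ### From models to triples, and the centre of `SL_n / μ_m`. -/

namespace SLMod

open AlgGrp Module CommutingPair

variable {n m : ℕ}

/-- A nontrivial torus contains an element `φ x` with `x` of order `n + 1`. Its lift `g` commutes
with `S, T, U` up to scalars `χ` with `χ ^ n = 1` and `χ ^ (n + 1) = 1`, hence exactly. So `g` is a
scalar, `g ^ n = 1`, and `φ x = 1`, although the coordinate function that separates `x` from `1` is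
a pullback along `φ`. -/
theorem not_containsNontrivialTorus_of_isModel (hn : 0 < n) (hmn : m ∣ n) {S T U : SL(n, ℂ)}
    {ζ α b : ℂ} {d k : ℕ} (hζ : IsPrimitiveRoot ζ d) (hα : α ≠ 0)
    (h : IsModel (toEnd S) (toEnd T) (toEnd U - 1) ζ α b d k) :
    ¬ ContainsNontrivialTorus (regularFunctions n m) (Subgroup.centralizer
      {(QuotientGroup.mk S : Grp n m), QuotientGroup.mk T, QuotientGroup.mk U}) := by
  have : Nonempty (Fin n) := ⟨⟨0, hn⟩⟩
  rintro ⟨K, ⟨r, φ, hφ, rfl⟩, hne, hle⟩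
  have hr : Nonempty (Fin r) := by
    by_contra hE
    rw [not_nonempty_iff] at hE
    refine hne ((Subgroup.eq_bot_iff_forall _).2 ?_)
    rintro _ ⟨w, rfl⟩
    rw [Subsingleton.elim w 1, map_one]
  obtain ⟨i⟩ := hr
  obtain ⟨ξ, hξp⟩ : ∃ ξ : ℂˣ, IsPrimitiveRoot ξ (n + 1) :=
    ⟨_, (Complex.isPrimitiveRoot_exp (n + 1) n.succ_ne_zero).isUnit_unit n.succ_ne_zero⟩
  let x : Fin r → ℂˣ := Pi.mulSingle i ξ
  have hx : x ^ (n + 1) = 1 := by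
    simp only [x]
    rw [← Pi.mulSingle_pow, hξp.pow_eq_one, Pi.mulSingle_one]
  obtain ⟨g, hg⟩ := QuotientGroup.mk_surjective (φ x)
  have hgc : ∀ R : SL(n, ℂ), (QuotientGroup.mk R : Grp n m) ∈
      ({(QuotientGroup.mk S : Grp n m), QuotientGroup.mk T, QuotientGroup.mk U} :
        Set (Grp n m)) → Commute (QuotientGroup.mk R : Grp n m) (QuotientGroup.mk g) := by
    intro R hR
    have h1 : φ x ∈ φ.range := ⟨x, rfl⟩
    rw [hg]
    exact Subgroup.mem_centralizer_iff.1 (hle h1) _ hR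
  have hgpow : (QuotientGroup.mk (g ^ (n + 1)) : Grp n m) = 1 := by
    rw [QuotientGroup.mk_pow, hg, ← map_pow, hx, map_one]
  obtain ⟨c, -, hc⟩ := (mem_mu_iff _).1 ((QuotientGroup.eq_one_iff _).1 hgpow)
  have hcn := pow_eq_one_of_toEnd hc
  have hc0 : c ≠ 0 := by
    rintro rfl
    rw [zero_pow hn.ne'] at hcn
    exact zero_ne_one hcn
  rw [toEnd_pow] at hc
  have hcomm : ∀ R : SL(n, ℂ), Commute (QuotientGroup.mk R : Grp n m) (QuotientGroup.mk g) →
      Commute (toEnd g) (toEnd R) := by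
    intro R hR
    obtain ⟨χ, hχ, hRg⟩ := exists_toEnd_comm hR
    have h1 := comm_pow hRg (n + 1)
    rw [hc] at h1
    have h2 : toEnd R = χ ^ (n + 1) • toEnd R := by
      have h3 : c • toEnd R = c • (χ ^ (n + 1) • toEnd R) := by
        rw [smul_comm]
        simpa using h1
      exact smul_right_injective _ hc0 h3
    have hR0 : toEnd R ≠ 0 := by
      intro h0
      have := toEnd_mul_inv R
      rw [h0, zero_mul] at this
      exact zero_ne_one this
    have h4 : χ ^ (n + 1) = 1 := smul_left_injective ℂ hR0 (by simpa using h2.symm)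
    have h5 : χ ^ n = 1 := by
      obtain ⟨q, hq⟩ := hmn
      rw [hq, pow_mul, hχ, one_pow]
    rw [pow_succ, h5, one_mul] at h4
    rw [h4, one_smul] at hRg
    exact hRg.symm
  have hgU := (hcomm U (hgc U (by simp))).sub_right (Commute.one_right _)
  obtain ⟨l, hl⟩ := h.eq_smul_one hζ hα (hcomm S (hgc S (by simp))) (hcomm T (hgc T (by simp))) hgU
    n.succ_ne_zero hc0 hc
  have hgn : g ^ n = 1 := by
    refine toEnd_injective ?_
    rw [toEnd_pow, hl, smul_pow, one_pow, pow_eq_one_of_toEnd hl, one_smul, toEnd_one]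
  have hφx : φ x = 1 := by
    rw [QuotientGroup.mk_pow, pow_succ, ← QuotientGroup.mk_pow, hgn, hg] at hgpow
    simpa using hgpow
  have hchar : (fun w : Fin r → ℂˣ => (w i : ℂ)) ∈ laurentFunctions r := by
    refine Submodule.subset_span ⟨Pi.single i 1, ?_⟩
    ext w
    change ∏ j, (w j : ℂ) ^ (Pi.single i 1 : Fin r → ℤ) j = w i
    rw [Finset.prod_eq_single_of_mem i (Finset.mem_univ i)]
    · simp
    · intro j _ hj
      simp [Pi.single_eq_of_ne hj]
  rw [← hφ] at hchar
  obtain ⟨f, -, hf⟩ := hchar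
  have h1 := congrFun hf x
  have h2 := congrFun hf 1
  rw [LinearMap.funLeft_apply, hφx] at h1
  rw [LinearMap.funLeft_apply, map_one, h1] at h2
  have h3 : ξ = 1 := Units.ext (by simpa [x] using h2)
  exact hξp.ne_one (by omega) h3

theorem isSemisimpleElt_of_pow_toEnd (hn : 0 < n) {S : SL(n, ℂ)} {d : ℕ} (hd : 0 < d) {a : ℂ}
    (h : toEnd S ^ d = a • (1 : End ℂ (Fin n → ℂ))) :
    IsSemisimpleElt (regularFunctions n m) (QuotientGroup.mk S) := by
  refine isSemisimpleElt_of_pow_eq_one (fun f hf => rightTranslation_mem _ hf)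
    (Nat.mul_pos hd hn) ?_
  rw [← toEnd_pow] at h
  -- A scalar matrix in `SL_n` has `n`-th power `1`.
  have h1 : S ^ (d * n) = 1 := by
    refine toEnd_injective ?_
    rw [pow_mul, toEnd_pow, h, smul_pow, one_pow, pow_eq_one_of_toEnd h, one_smul, toEnd_one]
  rw [← QuotientGroup.mk_pow, h1, QuotientGroup.mk_one]

theorem isN2Triple_of_isModel (hn : 0 < n) (hmn : m ∣ n) {S T U : SL(n, ℂ)}
    {ζ α b : ℂ} {d k : ℕ} (hd : 0 < d) (hdm : d ∣ m) (hζ : IsPrimitiveRoot ζ d) (hα : α ≠ 0)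
    (h : IsModel (toEnd S) (toEnd T) (toEnd U - 1) ζ α b d k) :
    IsN2Triple (regularFunctions n m) (QuotientGroup.mk S) (QuotientGroup.mk T)
      (QuotientGroup.mk U) where
  comm_st := commute_mk ((hζ.pow_eq_one_iff_dvd m).2 hdm) h.comm_st
  comm_su := commute_mk (ξ := 1) (one_pow m) (by
    simpa [mul_sub, sub_mul] using h.comm_sn.eq)
  comm_tu := commute_mk (ξ := 1) (one_pow m) (by
    simpa [mul_sub, sub_mul] using h.comm_tn.eq)
  semisimple_s := isSemisimpleElt_of_pow_toEnd hn hd (h.pow_s hζ.pow_eq_one)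
  semisimple_t := isSemisimpleElt_of_pow_toEnd hn hd h.pow_t
  unipotent_u := isUnipotentElt_mk (by
    have h1 : IsNilpotent (toEnd U - 1) := ⟨k, h.pow_eq_zero⟩
    have h2 : toEnd U - 1 =
        Matrix.toLinAlgEquiv' ((U : Matrix (Fin n) (Fin n) ℂ) - 1) := by
      rw [map_sub, map_one]; rfl
    rw [h2] at h1
    exact (IsNilpotent.map_iff Matrix.toLinAlgEquiv'.injective).1 h1)
  no_torus := not_containsNontrivialTorus_of_isModel hn hmn hζ hα h

/-- A central class commutes with the transvections modulo `μ_m`, hence exactly, because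
transvections are unipotent. A matrix commuting with all off-diagonal matrix units is a scalar. -/
theorem mk_mem_center_iff (hn : 0 < n) (g : SL(n, ℂ)) :
    (QuotientGroup.mk g : Grp n m) ∈ Subgroup.center (Grp n m) ↔ g ∈ mu n n := by
  constructor
  · intro hg
    rw [Subgroup.mem_center_iff] at hg
    have hcomm : Pairwise fun i j : Fin n =>
        Commute (Matrix.single i j (1 : ℂ)) (g : Matrix (Fin n) (Fin n) ℂ) := by
      intro i j hij
      let τ := Matrix.SpecialLinearGroup.transvection hij (1 : ℂ)
      have hτ : (τ : Matrix (Fin n) (Fin n) ℂ) = 1 + Matrix.single i j 1 :=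
        Matrix.SpecialLinearGroup.transvection_coe hij 1
      have hnil : IsNilpotent (toEnd τ - 1) := by
        refine ⟨2, ?_⟩
        rw [toEnd, hτ, map_add, map_one, add_sub_cancel_left, ← map_pow, pow_two,
          Matrix.single_mul_single_of_ne _ _ _ _ hij.symm, map_zero]
      have h1 := commute_toEnd_of_isNilpotent (m := m) hn hnil (g := g) (hg _).symm
      have h2 : g * τ = τ * g := toEnd_injective (by rw [toEnd_mul, toEnd_mul, h1.eq])
      have h3 := congrArg (fun A : SL(n, ℂ) => (A : Matrix (Fin n) (Fin n) ℂ)) h2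
      simp only [Matrix.SpecialLinearGroup.coe_mul, hτ, mul_add, add_mul, mul_one, one_mul] at h3
      exact (add_left_cancel h3).symm
    obtain ⟨ω, hω⟩ := Matrix.mem_range_scalar_of_commute_single hcomm
    have hω' := (toEnd_eq_smul_one_iff g ω).2 hω.symm
    exact (mem_mu_iff g).2 ⟨ω, pow_eq_one_of_toEnd hω', hω'⟩
  · intro hg
    rw [Subgroup.mem_center_iff]
    intro x
    induction x using QuotientGroup.induction_on with
    | H x => rw [← QuotientGroup.mk_mul, ← QuotientGroup.mk_mul, mu_comm hg x]

theorem card_mu (hn : 0 < n) {k : ℕ} (hk : k ∣ n) : Nat.card (mu n k) = k := by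
  have hk0 : 0 < k := Nat.pos_of_dvd_of_pos hk hn
  have : NeZero k := ⟨hk0.ne'⟩
  have : Nonempty (Fin n) := ⟨⟨0, hn⟩⟩
  have hroot : ∀ ζ : rootsOfUnity k ℂ, ((ζ : ℂˣ) : ℂ) ^ k = 1 := fun ζ => by
    rw [← Units.val_pow_eq_pow_val, (mem_rootsOfUnity k _).1 ζ.2, Units.val_one]
  have hex : ∀ ζ : rootsOfUnity k ℂ, ∃ g : mu n k,
      toEnd (g : SL(n, ℂ)) = ((ζ : ℂˣ) : ℂ) • (1 : End ℂ (Fin n → ℂ)) := by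
    intro ζ
    obtain ⟨q, hq⟩ := hk
    obtain ⟨g, hg⟩ := exists_toEnd_eq_smul_one (n := n) (ω := ((ζ : ℂˣ) : ℂ)) (by
      rw [hq, pow_mul, hroot, one_pow])
    exact ⟨⟨g, (mem_mu_iff g).2 ⟨_, hroot ζ, hg⟩⟩, hg⟩
  choose F hF using hex
  have hbij : Function.Bijective F := by
    constructor
    · intro ζ ξ h
      have h1 := hF ζ
      rw [h, hF ξ] at h1
      exact Subtype.ext (Units.ext (smul_left_injective ℂ
        (one_ne_zero : (1 : End ℂ (Fin n → ℂ)) ≠ 0) h1).symm)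
    · rintro ⟨g, hg⟩
      obtain ⟨ζ, hζ, hg'⟩ := (mem_mu_iff g).1 hg
      refine ⟨rootsOfUnity.mkOfPowEq ζ hζ, Subtype.ext (toEnd_injective ?_)⟩
      rw [hF, hg', rootsOfUnity.coe_mkOfPowEq]
  rw [← Nat.card_eq_of_bijective F hbij, Complex.card_rootsOfUnity]

theorem card_center (hn : 0 < n) (hmn : m ∣ n) : Nat.card (Subgroup.center (Grp n m)) = n / m := by
  have hm0 : 0 < m := Nat.pos_of_dvd_of_pos hmn hn
  let f : mu n n →* Grp n m := (QuotientGroup.mk' (mu n m)).comp (mu n n).subtype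
  have hrange : f.range = Subgroup.center (Grp n m) := by
    ext z
    induction z using QuotientGroup.induction_on with
    | H g =>
      constructor
      · rintro ⟨x, hx⟩
        rw [← hx]
        exact (mk_mem_center_iff hn _).2 x.2
      · intro hg
        exact ⟨⟨g, (mk_mem_center_iff hn g).1 hg⟩, rfl⟩
  have hle : mu n m ≤ mu n n := by
    intro g hg
    obtain ⟨ζ, hζ, hg'⟩ := (mem_mu_iff g).1 hg
    exact (mem_mu_iff g).2 ⟨ζ, pow_eq_one_of_toEnd hg', hg'⟩
  have hker : f.ker = (mu n m).subgroupOf (mu n n) := by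
    ext x
    rw [MonoidHom.mem_ker, Subgroup.mem_subgroupOf]
    exact QuotientGroup.eq_one_iff _
  have h1 := Subgroup.card_mul_index f.ker
  rw [Subgroup.index_ker, hrange, hker, Nat.card_congr (Subgroup.subgroupOfEquivOfLe hle).toEquiv,
    card_mu hn hmn, card_mu hn dvd_rfl] at h1
  exact (Nat.div_eq_of_eq_mul_right hm0 h1.symm).symm

end SLMod

/-! ### Generalities on classes of triples and torsors. -/

namespace AlgGrp

variable {G : Type} [Group G]

theorem tripleClass_eq_iff {s t u s' t' u' : G} : tripleClass s t u = tripleClass s' t' u' ↔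
    ∃ g : G, g * s' * g⁻¹ = s ∧ g * t' * g⁻¹ = t ∧ g * u' * g⁻¹ = u := by
  rw [tripleClass, tripleClass, Quotient.eq (r := MulAction.orbitRel (ConjAct G) (G × G × G)),
    MulAction.orbitRel_apply]
  constructor
  · rintro ⟨g, hg⟩
    simp only [Prod.smul_mk, ConjAct.smul_def, Prod.mk.injEq] at hg
    exact ⟨_, hg⟩
  · rintro ⟨g, hs, ht, hu⟩
    refine ⟨ConjAct.toConjAct g, ?_⟩
    simp [ConjAct.smul_def, hs, ht, hu]

theorem smul_tripleClass (z : Subgroup.center G × Subgroup.center G) (s t u : G) :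
    z • tripleClass s t u = tripleClass (z.1 * s) (z.2 * t) u := rfl

theorem IsTorsorOn.encard_eq {Z X : Type} [Group Z] [MulAction Z X] {S : Set X}
    (h : IsTorsorOn Z S) : S.encard = ENat.card Z := by
  obtain ⟨⟨x, hx⟩, hstable, htrans⟩ := h
  have hinj : Function.Injective fun z : Z => z • x := fun z w hzw =>
    (htrans x hx _ (hstable w x hx)).unique hzw rfl
  have hrange : Set.range (fun z : Z => z • x) = S := by
    ext y
    constructor
    · rintro ⟨z, rfl⟩
      exact hstable z x hx
    · intro hy
      exact (htrans x hx y hy).exists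
  rw [← hrange, ← Set.image_univ, hinj.encard_image, Set.encard_univ]

end AlgGrp

/-! ### The torsor property and the counts. -/

namespace SLMod

open AlgGrp Module CommutingPair

variable {n m : ℕ}

theorem exists_toEnd_eq_smul (hn : 0 < n) {f : End ℂ (Fin n → ℂ)} (hf : LinearMap.det f ≠ 0) :
    ∃ (g : SL(n, ℂ)) (c : ℂ), c ≠ 0 ∧ toEnd g = c • f := by
  obtain ⟨c, hc⟩ := IsAlgClosed.exists_pow_nat_eq (LinearMap.det f)⁻¹ hn
  obtain ⟨g, hg⟩ := exists_toEnd_eq (f := c • f) (by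
    rw [LinearMap.det_smul, Module.finrank_fin_fun, hc, inv_mul_cancel₀ hf])
  refine ⟨g, c, ?_, hg⟩
  rintro rfl
  rw [zero_pow hn.ne'] at hc
  exact inv_ne_zero hf hc.symm

theorem exists_toEnd_conj (hn : 0 < n) {S T N S' T' N' : End ℂ (Fin n → ℂ)} {ζ α b : ℂ} {d k : ℕ}
    (h : IsModel S T N ζ α b d k) (h' : IsModel S' T' N' ζ α b d k) :
    ∃ g : SL(n, ℂ), toEnd g * S = S' * toEnd g ∧ toEnd g * T = T' * toEnd g ∧
      toEnd g * N = N' * toEnd g := by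
  obtain ⟨e, he⟩ := h.exists_conj h'
  obtain ⟨g, κ, -, hg⟩ := exists_toEnd_eq_smul hn (f := (e : End ℂ (Fin n → ℂ)))
    e.isUnit_det'.ne_zero
  refine ⟨g, LinearMap.ext fun x => ?_, LinearMap.ext fun x => ?_, LinearMap.ext fun x => ?_⟩ <;>
    simp [hg, he]

/-- Both models have `d k = n`, hence the same `k`. Scaling `S` by `α' / α` and `T` by a `d`-th root
of `b' / b` equates the remaining parameters, so the scaled triples are conjugate. -/
theorem exists_center_smul_eq (hn : 0 < n) (hm : 0 < m) (hmn : m ∣ n) {γ : SL(n, ℂ)}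
    {ζ : ℂ} {d : ℕ} (hd : 0 < d) (hζ : IsPrimitiveRoot ζ d)
    (hγ : toEnd γ = ζ • (1 : End ℂ (Fin n → ℂ))) {s t u s' t' u' : Grp n m}
    (h : IsN2Triple (regularFunctions n m) s t u) (hst : liftCommutator s t = γ)
    (h' : IsN2Triple (regularFunctions n m) s' t' u') (hst' : liftCommutator s' t' = γ) :
    ∃ z : Subgroup.center (Grp n m) × Subgroup.center (Grp n m),
      z • tripleClass s t u = tripleClass s' t' u' := by
  obtain ⟨S, T, U, α, b, k, rfl, rfl, rfl, hα, hb, hk, hmod⟩ :=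
    exists_isModel_lift hn hm hmn hd hζ hγ h hst
  obtain ⟨S', T', U', α', b', k', rfl, rfl, rfl, hα', hb', hk', hmod'⟩ :=
    exists_isModel_lift hn hm hmn hd hζ hγ h' hst'
  obtain rfl : k = k' := Nat.eq_of_mul_eq_mul_left hd (hk.trans hk'.symm)
  obtain ⟨ω, hω⟩ := IsAlgClosed.exists_pow_nat_eq (b' / b) hd
  have hω0 : ω ≠ 0 := by
    rintro rfl
    rw [zero_pow hd.ne'] at hω
    exact div_ne_zero hb' hb hω.symm
  have hsc := hmod.smul (α' / α) hω0
  rw [div_mul_cancel₀ _ hα, hω, div_mul_cancel₀ _ hb] at hsc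
  obtain ⟨g, hgS, hgT, hgU⟩ := exists_toEnd_conj hn hsc hmod'
  have hscalar : ∀ (c : ℂ) (R R' : SL(n, ℂ)), toEnd g * (c • toEnd R) = toEnd R' * toEnd g →
      ∃ z : Subgroup.center (Grp n m),
        (QuotientGroup.mk g : Grp n m) * ((z : Grp n m) * QuotientGroup.mk R) *
            (QuotientGroup.mk g)⁻¹ =
          QuotientGroup.mk R' := by
    intro c R R' hR
    -- Determinants show that the scaling factor is an `n`-th root of unity, so it represents a
    -- central element.
    have hc : c ^ n = 1 := by
      have := congrArg LinearMap.det hR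
      rw [map_mul, map_mul, LinearMap.det_smul, det_toEnd, det_toEnd, det_toEnd,
        Module.finrank_fin_fun] at this
      simpa using this
    obtain ⟨Z, hZ⟩ := exists_toEnd_eq_smul_one hc
    refine ⟨⟨QuotientGroup.mk Z, (mk_mem_center_iff hn Z).2 ((mem_mu_iff Z).2 ⟨c, hc, hZ⟩)⟩, ?_⟩
    have h1 : g * (Z * R) = R' * g := toEnd_injective (by
      rw [toEnd_mul, toEnd_mul, hZ, smul_mul_assoc, one_mul, hR, toEnd_mul])
    rw [mul_inv_eq_iff_eq_mul]
    exact congrArg (QuotientGroup.mk (s := mu n m)) h1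
  obtain ⟨z₁, hz₁⟩ := hscalar _ _ _ hgS
  obtain ⟨z₂, hz₂⟩ := hscalar _ _ _ hgT
  refine ⟨(z₁, z₂), ?_⟩
  rw [smul_tripleClass]
  symm
  refine tripleClass_eq_iff.2 ⟨QuotientGroup.mk g, hz₁, hz₂, ?_⟩
  have h1 : g * U = U' * g := toEnd_injective (by
    rw [mul_sub, sub_mul, mul_one, one_mul, sub_left_inj] at hgU
    rw [toEnd_mul, hgU, toEnd_mul])
  rw [mul_inv_eq_iff_eq_mul]
  exact congrArg (QuotientGroup.mk (s := mu n m)) h1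

/-- On lifts, `g R g⁻¹ = ω ξ R` with `ξ ^ m = 1`. As `R ^ d` is a nonzero scalar, `d`-th powers give
`(ω ξ) ^ d = 1`, and `d ∣ m` gives `ω ^ m = 1`. -/
theorem center_eq_one_of_conj (hn : 0 < n) {d : ℕ} (hdm : d ∣ m) {R : SL(n, ℂ)} {a : ℂ}
    (ha : a ≠ 0) (hR : toEnd R ^ d = a • (1 : End ℂ (Fin n → ℂ)))
    {z : Subgroup.center (Grp n m)} {g : Grp n m}
    (h : g * QuotientGroup.mk R * g⁻¹ = (z : Grp n m) * QuotientGroup.mk R) : z = 1 := by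
  have : Nonempty (Fin n) := ⟨⟨0, hn⟩⟩
  obtain ⟨z, hz⟩ := z
  induction g using QuotientGroup.induction_on with
  | H g =>
  induction z using QuotientGroup.induction_on with
  | H Z =>
  obtain ⟨ω, -, hω⟩ := (mem_mu_iff Z).1 ((mk_mem_center_iff hn Z).1 hz)
  have h1 : (QuotientGroup.mk (Z * R) : Grp n m) = QuotientGroup.mk (g * R * g⁻¹) := h.symm
  obtain ⟨ξ, hξ, hξ'⟩ := (mem_mu_iff _).1 (QuotientGroup.eq.1 h1)
  have h2 : toEnd (g * R * g⁻¹) = (ω * ξ) • toEnd R := by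
    rw [← mul_inv_cancel_left (Z * R) (g * R * g⁻¹), toEnd_mul, hξ', toEnd_mul, hω]
    simp [smul_smul, mul_comm]
  have h3 : (ω * ξ) ^ d = 1 := by
    have h4 := congrArg (· ^ d) h2
    simp only [← toEnd_pow, conj_pow, smul_pow] at h4
    rw [toEnd_mul, toEnd_mul, toEnd_pow, hR, mul_smul_comm, mul_one, smul_mul_assoc, toEnd_mul_inv,
      smul_smul] at h4
    have h5 := smul_left_injective ℂ (one_ne_zero : (1 : End ℂ (Fin n → ℂ)) ≠ 0) h4
    exact mul_right_cancel₀ ha (by rw [one_mul]; exact h5.symm)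
  have h6 : ω ^ m = 1 := by
    obtain ⟨q, hq⟩ := hdm
    have h7 : (ω * ξ) ^ m = 1 := by rw [hq, pow_mul, h3, one_pow]
    rwa [mul_pow, hξ, mul_one] at h7
  exact Subtype.ext ((QuotientGroup.eq_one_iff _).2 ((mem_mu_iff Z).2 ⟨ω, h6, hω⟩))

theorem det_one_add_of_isNilpotent {V : Type*} [AddCommGroup V] [Module ℂ V]
    [FiniteDimensional ℂ V] {N : End ℂ V} (hN : IsNilpotent N) : LinearMap.det (1 + N) = 1 := by
  have h1 := hN.neg.charpoly_eq_X_pow_finrank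
  have h2 := congrArg (Polynomial.eval 1) h1
  rw [LinearMap.eval_charpoly] at h2
  simpa using h2

theorem exists_isModel_toEnd (hn : 0 < n) {d : ℕ} (hd : d ∣ n) {ζ : ℂ} (hζ : ζ ^ d = 1) :
    ∃ (S T U : SL(n, ℂ)) (α b : ℂ) (k : ℕ), α ≠ 0 ∧
      IsModel (toEnd S) (toEnd T) (toEnd U - 1) ζ α b d k := by
  obtain ⟨k, rfl⟩ := hd
  have hd : 0 < d := Nat.pos_of_mul_pos_right hn
  have hk : 0 < k := Nat.pos_of_mul_pos_left hn
  obtain ⟨S, T, N, h⟩ := exists_isModel hd hk hζ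
    ((Pi.basisFun ℂ (Fin (d * k))).reindex finProdFinEquiv.symm)
  have hdet : ∀ R : End ℂ (Fin (d * k) → ℂ), R ^ d = 1 → LinearMap.det R ≠ 0 := by
    intro R hR h0
    have := congrArg LinearMap.det hR
    rw [map_pow, h0, zero_pow hd.ne', map_one] at this
    exact zero_ne_one this
  obtain ⟨S', c, hc, hS'⟩ := exists_toEnd_eq_smul hn
    (hdet S (by rw [h.pow_s hζ, one_pow, one_smul]))
  obtain ⟨T', c', hc', hT'⟩ := exists_toEnd_eq_smul hn
    (hdet T (by rw [h.pow_t, one_smul]))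
  obtain ⟨U, hU⟩ := exists_toEnd_eq (det_one_add_of_isNilpotent ⟨k, h.pow_eq_zero⟩)
  refine ⟨S', T', U, c * 1, c' ^ d * 1, k, by simpa using hc, ?_⟩
  rw [hS', hT', hU, add_sub_cancel_left]
  exact h.smul c hc'

theorem isTorsorOn_N2At (hn : 0 < n) (hmn : m ∣ n) {γ : SL(n, ℂ)} (hγm : γ ∈ mu n m) :
    IsTorsorOn (Subgroup.center (Grp n m) × Subgroup.center (Grp n m)) (N2At n m γ) := by
  have hm : 0 < m := Nat.pos_of_dvd_of_pos hmn hn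
  obtain ⟨ζ, hζm, hγ⟩ := (mem_mu_iff γ).1 hγm
  have hζ := IsPrimitiveRoot.orderOf ζ
  have hdm : orderOf ζ ∣ m := orderOf_dvd_of_pow_eq_one hζm
  have hd : 0 < orderOf ζ := Nat.pos_of_dvd_of_pos hdm hm
  refine ⟨?_, ?_, ?_⟩
  · obtain ⟨S, T, U, α, b, k, hα, h⟩ := exists_isModel_toEnd hn (hdm.trans hmn) hζ.pow_eq_one
    exact ⟨_, _, _, _, isN2Triple_of_isModel hn hmn hd hdm hζ hα h, liftCommutator_eq hγ h.comm_st,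
      rfl⟩
  · rintro ⟨⟨z₁, hz₁⟩, ⟨z₂, hz₂⟩⟩ _ ⟨s, t, u, h, hst, rfl⟩
    obtain ⟨S, T, U, α, b, k, rfl, rfl, rfl, hα, -, -, hmod⟩ :=
      exists_isModel_lift hn hm hmn hd hζ hγ h hst
    induction z₁ using QuotientGroup.induction_on with
    | H Z₁ =>
    induction z₂ using QuotientGroup.induction_on with
    | H Z₂ =>
    obtain ⟨c₁, hc₁, hZ₁⟩ := (mem_mu_iff Z₁).1 ((mk_mem_center_iff hn Z₁).1 hz₁)
    obtain ⟨c₂, hc₂, hZ₂⟩ := (mem_mu_iff Z₂).1 ((mk_mem_center_iff hn Z₂).1 hz₂)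
    have hc0 : ∀ c : ℂ, c ^ n = 1 → c ≠ 0 := by
      rintro c hc rfl
      rw [zero_pow hn.ne'] at hc
      exact zero_ne_one hc
    have hsc := hmod.smul c₁ (hc0 c₂ hc₂)
    have h1 : ∀ (c : ℂ) (Z R : SL(n, ℂ)), toEnd Z = c • (1 : End ℂ (Fin n → ℂ)) →
        c • toEnd R = toEnd (Z * R) := by
      intro c Z R hZ
      rw [toEnd_mul, hZ, smul_mul_assoc, one_mul]
    rw [h1 _ _ _ hZ₁, h1 _ _ _ hZ₂] at hsc
    exact ⟨QuotientGroup.mk (Z₁ * S), QuotientGroup.mk (Z₂ * T), QuotientGroup.mk U,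
      isN2Triple_of_isModel hn hmn hd hdm hζ (mul_ne_zero (hc0 c₁ hc₁) hα) hsc,
      liftCommutator_eq hγ hsc.comm_st, rfl⟩
  · rintro _ ⟨s, t, u, h, hst, rfl⟩ _ ⟨s', t', u', h', hst', rfl⟩
    obtain ⟨z, hz⟩ := exists_center_smul_eq hn hm hmn hd hζ hγ h hst h' hst'
    refine ⟨z, hz, fun w hw => ?_⟩
    -- Uniqueness reduces to trivial stabilizers.
    have h1 : (z⁻¹ * w) • tripleClass s t u = tripleClass s t u := by
      rw [mul_smul, hw, ← hz, inv_smul_smul]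
    obtain ⟨S, T, U, α, b, k, rfl, rfl, rfl, hα, hb, -, hmod⟩ :=
      exists_isModel_lift hn hm hmn hd hζ hγ h hst
    rw [smul_tripleClass, tripleClass_eq_iff] at h1
    obtain ⟨g, hgs, hgt, -⟩ := h1
    have h2 := center_eq_one_of_conj hn hdm (pow_ne_zero _ hα) (hmod.pow_s hζ.pow_eq_one) hgs
    have h3 := center_eq_one_of_conj hn hdm hb hmod.pow_t hgt
    exact (inv_mul_eq_one.1 (Prod.ext h2 h3)).symm

theorem encard_N2At (hn : 0 < n) (hmn : m ∣ n) {γ : SL(n, ℂ)} (hγm : γ ∈ mu n m) :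
    (N2At n m γ).encard = (((n / m) ^ 2 : ℕ) : ℕ∞) := by
  have hm : 0 < m := Nat.pos_of_dvd_of_pos hmn hn
  have hcard := card_center hn hmn
  have : Finite (Subgroup.center (Grp n m)) := Nat.finite_of_card_ne_zero (by
    rw [hcard]
    exact (Nat.div_pos (Nat.le_of_dvd hn hmn) hm).ne')
  rw [(isTorsorOn_N2At hn hmn hγm).encard_eq, ENat.card_eq_coe_natCard, Nat.card_prod,
    hcard, pow_two]

theorem N2_eq_iUnion : N2 n m = ⋃ γ : mu n m, N2At n m γ := by
  ext c
  rw [Set.mem_iUnion]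
  constructor
  · rintro ⟨s, t, u, h, rfl⟩
    induction s using QuotientGroup.induction_on with
    | H S =>
    induction t using QuotientGroup.induction_on with
    | H T =>
    obtain ⟨ξ, hξ, hST⟩ := exists_toEnd_comm h.comm_st
    have h1 : S * T = S * T * S⁻¹ * T⁻¹ * (T * S) := by group
    have h2 : S * T * S⁻¹ * T⁻¹ ∈ mu n m := by
      refine (mem_mu_iff _).2 ⟨ξ, hξ, ?_⟩
      rw [mul_assoc (S * T), ← mul_inv_rev, toEnd_mul, toEnd_mul, hST, smul_mul_assoc, ← toEnd_mul,
        toEnd_mul_inv]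
    exact ⟨⟨_, h2⟩, _, _, u, h, rfl, rfl⟩
  · rintro ⟨γ, s, t, u, h, -, rfl⟩
    exact ⟨s, t, u, h, rfl⟩

/-- Conjugating a pair conjugates the commutator of its lifts, which is central; so `γ` depends only
on the class. -/
theorem pairwise_disjoint_N2At :
    Pairwise (Function.onFun Disjoint fun γ : mu n m => N2At n m γ) := by
  rintro ⟨γ, hγ⟩ ⟨γ', hγ'⟩ hne
  refine Set.disjoint_left.2 ?_
  rintro _ ⟨s, t, u, -, hst, rfl⟩ ⟨s', t', u', -, hst', hc⟩
  refine hne (Subtype.ext ?_)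
  obtain ⟨g, rfl, rfl, -⟩ := tripleClass_eq_iff.1 hc
  rw [← hst, ← hst']
  induction g using QuotientGroup.induction_on with
  | H g =>
  induction s' using QuotientGroup.induction_on with
  | H S =>
  induction t' using QuotientGroup.induction_on with
  | H T =>
  have h1 : S * T * S⁻¹ * T⁻¹ = γ' := hst'
  change g * S * g⁻¹ * (g * T * g⁻¹) * (g * S * g⁻¹)⁻¹ * (g * T * g⁻¹)⁻¹ = S * T * S⁻¹ * T⁻¹
  have h2 : g * S * g⁻¹ * (g * T * g⁻¹) * (g * S * g⁻¹)⁻¹ * (g * T * g⁻¹)⁻¹ =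
      g * (S * T * S⁻¹ * T⁻¹) * g⁻¹ := by group
  rw [h2, h1, ← mu_comm hγ', mul_inv_cancel_right]

theorem encard_N2 (hn : 0 < n) (hmn : m ∣ n) : (N2 n m).encard = ((n ^ 2 / m : ℕ) : ℕ∞) := by
  have hm : 0 < m := Nat.pos_of_dvd_of_pos hmn hn
  have hcard := card_mu hn hmn
  have : Finite (mu n m) := Nat.finite_of_card_ne_zero (by rw [hcard]; exact hm.ne')
  have : Fintype (mu n m) := Fintype.ofFinite _
  rw [N2_eq_iUnion, Set.encard_iUnion_of_finite pairwise_disjoint_N2At, finsum_eq_sum_of_fintype,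
    Finset.sum_congr rfl fun γ _ => encard_N2At hn hmn γ.2, Finset.sum_const, Finset.card_univ,
    ← Nat.card_eq_fintype_card, hcard]
  -- With `n = m q`, both sides equal `m q ^ 2`, so the natural-number divisions are exact.
  obtain ⟨q, rfl⟩ := hmn
  rw [Nat.mul_div_cancel_left q hm, mul_pow, pow_two m, mul_assoc, Nat.mul_div_cancel_left _ hm]
  simp

end SLMod

end

theorem mainTheorem11 (n m : ℕ) (hn : 0 < n) (hm : m ∣ n) :
    (∀ γ ∈ SLMod.mu n m,
      AlgGrp.IsTorsorOn
        (Subgroup.center (SLMod.Grp n m) × Subgroup.center (SLMod.Grp n m))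
        (SLMod.N2At n m γ) ∧
      (SLMod.N2At n m γ).encard = (((n / m) ^ 2 : ℕ) : ℕ∞)) ∧
    (SLMod.N2 n m).encard = ((n ^ 2 / m : ℕ) : ℕ∞) :=
  ⟨fun _ hγ => ⟨SLMod.isTorsorOn_N2At hn hm hγ, SLMod.encard_N2At hn hm hγ⟩,
    SLMod.encard_N2 hn hm⟩
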